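/- For a real random variable $X$ on a probability space $(\Omega,\mathcal A,\mathbb P)$ and $t\ge 0$ let $$\mathrm{Conc}(X,t):=\sup_{x\in\mathbb R}\mathbb P(X\in[x,x+t]),$$ and for $\lambda\ge 0$ let $$G(\lambda):=e^{-\lambda}\bigl(I_0(\lambda)+I_1(\lambda)\bigr),\qquad I_k(\lambda)=\sum_{m=0}^\infty\frac{(\lambda/2)^{2m+k}}{m!\,(m+k)!},$$ where $I_k$ is the modified Bessel function of the first kind of order $k$. Let $n\ge 0$, let $X_1,\dots,X_n$ be independent real random variables on a common probability space, and let $t\in[0,\infty)$. For $j=1,\dots,n$ put $$h_j(y):=\inf\{x\in\mathbb R:\mathbb P(X_j\le x)\ge y\}\quad(0<y<1),\qquad p_j:=2\int_0^{1/2}\mathbf 1_{(t,\infty)}\bigl(h_j(1-y)-h_j(y)\bigr)\,dy .$$ Then $p_j\ge 1-\mathrm{Conc}(X_j,t)$ for every $j$, and $$\mathrm{Conc}\Bigl(\sum_{j=1}^nX_j,\,t\Bigr)\le G\Bigl(\sum_{j=1}^np_j\Bigr)\le G\Bigl(\sum_{j=1}^n\bigl(1-\mathrm{Conc}(X_j,t)\bigr)\Bigr);$$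 in particular $$\mathrm{Conc}\Bigl(\sum_{j=1}^nX_j,\,t\Bigr)\le\sqrt{\tfrac2\pi}\,\Bigl(\tfrac14+\sum_{j=1}^np_j\Bigr)^{-1/2}\tag{1}$$ and $$\mathrm{Conc}\Bigl(\sum_{j=1}^nX_j,\,t\Bigr)\le\Bigl(1+\sum_{j=1}^n\bigl(1-\mathrm{Conc}(X_j,t)\bigr)\Bigr)^{-1/2}.$$ The constant $\sqrt{2/\pi}$ in (1) is optimal: for every $t\ge0$ and every real $C<\sqrt{2/\pi}$ there are $n$ and independent real random variables $X_1,\dots,X_n$ such that $\mathrm{Conc}(\sum_{j=1}^nX_j,t)>C\,(\frac14+\sum_{j=1}^np_j)^{-1/2}$. Moreover, if $t=1$ and $X_1,X_2,\dots$ are independent with $\mathbb P(X_j=1)=\mathbb P(X_j=-1)=\frac12$, then $p_j=1$ for every $j$ and $$\mathrm{Conc}\Bigl(\sum_{j=1}^nX_j,\,1\Bigr)\sim\sqrt{\tfrac2\pi}\,\Bigl(\sum_{j=1}^np_j\Bigr)^{-1/2}\qquad(n\to\infty).$$ -/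

import Mathlib

open MeasureTheory ProbabilityTheory Filter Asymptotics

namespace Concentration

noncomputable section

/-- The modified Bessel function `I_k` of the first kind of order `k : ℕ` at a real argument,
given by its everywhere convergent power series `∑ (x/2)^(2m+k) / (m! (m+k)!)`. -/
def besselI (k : ℕ) (x : ℝ) : ℝ :=
  ∑' m : ℕ, (x / 2) ^ (2 * m + k) / ((m.factorial : ℝ) * ((m + k).factorial : ℝ))

/-- `G(l) = exp(-l) (I_0(l) + I_1(l))`. -/
def G (l : ℝ) : ℝ :=
  Real.exp (-l) * (besselI 0 l + besselI 1 l)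

/-- The concentration function `Conc(X, t) = sup_{x ∈ ℝ} P(X ∈ [x, x + t])`. -/
def conc {Ω : Type*} [MeasurableSpace Ω] (P : Measure Ω) (X : Ω → ℝ) (t : ℝ) : ℝ :=
  ⨆ x : ℝ, P.real {ω | X ω ∈ Set.Icc x (x + t)}

/-- The quantile function `h(y) = inf {x ∈ ℝ : P(X ≤ x) ≥ y}`, meant for `0 < y < 1`. -/
def quantile {Ω : Type*} [MeasurableSpace Ω] (P : Measure Ω) (X : Ω → ℝ) (y : ℝ) : ℝ :=
  sInf {x : ℝ | y ≤ P.real {ω | X ω ≤ x}}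

/-- `p = 2 ∫_0^{1/2} 1_{]t,∞[}(h(1-y) - h(y)) dy`, where `h` is the quantile function of `X`. -/
def spreadProb {Ω : Type*} [MeasurableSpace Ω] (P : Measure Ω) (X : Ω → ℝ) (t : ℝ) : ℝ :=
  2 * ∫ y in (0 : ℝ)..(1 / 2),
    (Set.Ioi t).indicator (fun _ => (1 : ℝ)) (quantile P X (1 - y) - quantile P X y)

end

end Concentration

namespace Concentration

open scoped Real Nat Topology

/-! ### Cosine moments and central binomial probabilities -/

section Cosine

/-! Realise each `X j` as its quantile function at an independent uniform variable `u j`. Reflecting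
any set of coordinates by `y ↦ 1 - y` preserves the uniform law on the cube. So, given the unordered
pairs `{u j, 1 - u j}`, the sum is made of independent fair choices between two quantiles. If `k` of
these pairs of quantiles are more than `t` apart, Erdős' Littlewood–Offord argument (Sperner's
theorem, `card_choices_le`) bounds the conditional probability of a closed interval of length `t` by
`centralProb k`, the largest symmetric binomial point mass.

It remains to average over `k`, a sum of independent indicators with means `p j`. Since `π *
centralProb k` is the integral of `cos x ^ k * (1 + cos x)` over `[0, π]`, the average factorises
under the integral into `∏ (1 - p j * (1 - cos x))` (`integral_centralProb_card`). Kanter's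
inequality `integral_prod_le_besselIntegral` replaces this product by `exp (-l * (1 - cos x))` with
`l = ∑ p j`, and the resulting integral is `π * G l`. By Hölder with weights `p j / l`, only a
single `p` has to be treated; there a layer-cake comparison reduces the claim to an inequality
between masses of level sets (`cosMeasure_level_le`), which is the analytic core.

The closed-form bounds hold because `(1/4 + l) * G l ^ 2` increases, with limit at most `2/π` by a
Gaussian comparison, while `(1 + l) * G l ^ 2` decreases on `l ≥ 0` from the value `1`. Optimality
comes from symmetric signs, whose sum has an atom of mass `centralProb n`, bounded below by Wallis'
product. -/

theorem integral_cos_pow_even (m : ℕ) :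
    ∫ x in (0 : ℝ)..π, Real.cos x ^ (2 * m) = π * (m.centralBinom / 4 ^ m) := by
  induction m with
  | zero => simp
  | succ m ih =>
    have h : ((m : ℝ) + 1) * (m + 1).centralBinom = 2 * (2 * m + 1) * m.centralBinom := by
      exact_mod_cast Nat.succ_mul_centralBinom_succ m
    rw [show 2 * (m + 1) = 2 * m + 2 by ring, integral_cos_pow, ih]
    simp only [Real.sin_pi, Real.sin_zero, mul_zero, sub_zero, zero_div, zero_add]
    have h2 : ((m + 1).centralBinom : ℝ) = 2 * (2 * m + 1) * m.centralBinom / (m + 1) := by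
      field_simp
      linarith
    rw [h2]
    push_cast
    field_simp
    ring

theorem integral_cos_pow_odd (m : ℕ) :
    ∫ x in (0 : ℝ)..π, Real.cos x ^ (2 * m + 1) = 0 := by
  induction m with
  | zero => simp
  | succ m ih =>
    rw [show 2 * (m + 1) + 1 = (2 * m + 1) + 2 by ring, integral_cos_pow, ih]
    simp

/-- The largest point mass of the symmetric binomial law with `k` trials. -/
noncomputable def centralProb (k : ℕ) : ℝ := (k.choose (k / 2) : ℝ) / 2 ^ k

theorem centralProb_even (m : ℕ) : centralProb (2 * m) = m.centralBinom / 4 ^ m := by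
  rw [centralProb, Nat.mul_div_cancel_left _ two_pos, pow_mul, Nat.centralBinom]
  norm_num

theorem centralProb_odd (m : ℕ) :
    centralProb (2 * m + 1) = (m + 1).centralBinom / 4 ^ (m + 1) := by
  have h : (m + 1).centralBinom = 2 * (2 * m + 1).choose m := by
    rw [Nat.centralBinom, show 2 * (m + 1) = (2 * m + 1) + 1 by ring, Nat.choose_succ_succ,
      Nat.choose_symm_half]
    ring
  rw [centralProb, show (2 * m + 1) / 2 = m by omega, h,
    show (4 : ℝ) ^ (m + 1) = 2 * 2 ^ (2 * m + 1) by
      rw [show (4 : ℝ) = 2 ^ 2 by norm_num, ← pow_mul]; ring]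
  push_cast
  field_simp

/-- Exactly one of `k` and `k + 1` is even, and only that power of the cosine has a nonzero
integral. The weight `1 + cos x` thus treats both parities by one formula. -/
theorem integral_cos_pow_mul_one_add_cos (k : ℕ) :
    ∫ x in (0 : ℝ)..π, Real.cos x ^ k * (1 + Real.cos x) = π * centralProb k := by
  have h : ∫ x in (0 : ℝ)..π, Real.cos x ^ k * (1 + Real.cos x)
      = (∫ x in (0 : ℝ)..π, Real.cos x ^ k) + ∫ x in (0 : ℝ)..π, Real.cos x ^ (k + 1) := by
    rw [← intervalIntegral.integral_add
      (Continuous.intervalIntegrable (by fun_prop) _ _)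
      (Continuous.intervalIntegrable (by fun_prop) _ _)]
    congr 1
    ext x
    ring
  rw [h]
  obtain ⟨m, rfl | rfl⟩ := Nat.even_or_odd' k
  · rw [integral_cos_pow_even, integral_cos_pow_odd, centralProb_even, add_zero]
  · rw [show 2 * m + 1 + 1 = 2 * (m + 1) by ring, integral_cos_pow_even, integral_cos_pow_odd,
      centralProb_odd, zero_add]

/-- Wallis' partial products stay below `π / 2`, which bounds the central binomial coefficient from
below. The shift `n + 2` is what this gives for odd `n`; for even `n` it would give `n + 1`. -/
theorem sqrt_le_centralProb (n : ℕ) : √(2 / (π * (n + 2))) ≤ centralProb n := by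
  have key (m : ℕ) : √(2 / (π * (2 * m + 1))) ≤ m.centralBinom / 4 ^ m := by
    apply Real.sqrt_le_iff.2 ⟨by positivity, ?_⟩
    have hW := Real.Wallis.W_le m
    rw [Real.Wallis.W_eq_factorial_ratio] at hW
    have hc : (m.centralBinom : ℝ) = (2 * m)! / (m ! * m !) := by
      have h := Nat.choose_mul_factorial_mul_factorial (show m ≤ 2 * m by omega)
      rw [show 2 * m - m = m by omega] at h
      rw [Nat.centralBinom, eq_div_iff (by positivity), ← mul_assoc]
      exact_mod_cast h
    have h16 : (2 : ℝ) ^ (4 * m) = (4 ^ m) ^ 2 := by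
      rw [← pow_mul, show (4 : ℝ) = 2 ^ 2 by norm_num, ← pow_mul]
      ring_nf
    rw [h16, div_le_div_iff₀ (by positivity) (by positivity)] at hW
    rw [hc, div_pow, div_pow, div_div, div_le_div_iff₀ (by positivity) (by positivity)]
    nlinarith [hW]
  obtain ⟨m, rfl | rfl⟩ := Nat.even_or_odd' n
  · rw [centralProb_even]
    refine le_trans (Real.sqrt_le_sqrt ?_) (key m)
    push_cast
    gcongr
    norm_num
  · rw [centralProb_odd]
    refine le_trans (Real.sqrt_le_sqrt ?_) (key (m + 1))
    push_cast
    apply le_of_eq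
    ring

end Cosine

/-! ### Integral representation of `G` and its algebraic bounds -/

section BesselIntegral

theorem hasSum_integral_exp_mul_cos_pow (l : ℝ) (j : ℕ) :
    HasSum (fun k : ℕ => l ^ k / k ! * ∫ x in (0 : ℝ)..π, Real.cos x ^ (k + j))
      (∫ x in (0 : ℝ)..π, Real.exp (l * Real.cos x) * Real.cos x ^ j) := by
  have hsum : Summable fun k : ℕ => |l| ^ k / k ! := Real.summable_pow_div_factorial |l|
  have h := intervalIntegral.hasSum_integral_of_dominated_convergence (μ := volume)
    (a := (0 : ℝ)) (b := π)
    (F := fun (k : ℕ) (x : ℝ) => l ^ k / k ! * Real.cos x ^ (k + j))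
    (f := fun x => Real.exp (l * Real.cos x) * Real.cos x ^ j)
    (fun k _ => |l| ^ k / k !)
    (fun k => Continuous.aestronglyMeasurable (by fun_prop))
    (fun k => ae_of_all _ fun x _ => by
      rw [Real.norm_eq_abs, abs_mul, abs_div, abs_pow, abs_pow, Nat.abs_cast]
      exact mul_le_of_le_one_right (by positivity)
        (pow_le_one₀ (abs_nonneg _) (Real.abs_cos_le_one x)))
    (ae_of_all _ fun x _ => hsum)
    (Continuous.intervalIntegrable (by fun_prop) _ _)
    (ae_of_all _ fun x _ => by
      have h1 : HasSum (fun k : ℕ => (l * Real.cos x) ^ k / k !) (Real.exp (l * Real.cos x)) := by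
        rw [Real.exp_eq_exp_ℝ]
        exact NormedSpace.expSeries_div_hasSum_exp _
      refine (h1.mul_right (Real.cos x ^ j)).congr_fun ?_
      intro k
      rw [mul_pow, pow_add]
      ring)
  simpa [intervalIntegral.integral_const_mul] using h

theorem besselI_zero_eq (l : ℝ) :
    π * besselI 0 l = ∫ x in (0 : ℝ)..π, Real.exp (l * Real.cos x) := by
  have h := hasSum_integral_exp_mul_cos_pow l 0
  have hinj : Function.Injective fun m : ℕ => 2 * m := fun a b h => by simpa using h
  rw [← hinj.hasSum_iff] at h
  · simp only [pow_zero, mul_one] at h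
    rw [← h.tsum_eq, besselI, ← tsum_mul_left]
    congr 1
    ext m
    have hc : (m.centralBinom : ℝ) = (2 * m)! / (m ! * m !) := by
      have h := Nat.choose_mul_factorial_mul_factorial (show m ≤ 2 * m by omega)
      rw [show 2 * m - m = m by omega] at h
      rw [Nat.centralBinom, eq_div_iff (by positivity), ← mul_assoc]
      exact_mod_cast h
    simp only [Function.comp, add_zero]
    rw [integral_cos_pow_even, hc, div_pow, pow_mul 2 2 m]
    field_simp
    norm_num
  · intro k hk
    obtain ⟨m, rfl | rfl⟩ := Nat.even_or_odd' k
    · exact absurd ⟨m, rfl⟩ hk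
    · rw [add_zero, integral_cos_pow_odd, mul_zero]

theorem besselI_one_eq (l : ℝ) :
    π * besselI 1 l = ∫ x in (0 : ℝ)..π, Real.exp (l * Real.cos x) * Real.cos x := by
  have h := hasSum_integral_exp_mul_cos_pow l 1
  have hinj : Function.Injective fun m : ℕ => 2 * m + 1 := fun a b h => by simpa using h
  rw [← hinj.hasSum_iff] at h
  · simp only [pow_one] at h
    rw [← h.tsum_eq, besselI, ← tsum_mul_left]
    congr 1
    ext m
    have hc : ((m + 1).centralBinom : ℝ) = (2 * m + 2) * (2 * m + 1)! / ((m + 1)! * (m + 1)!) := by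
      have h := Nat.choose_mul_factorial_mul_factorial (show m + 1 ≤ 2 * (m + 1) by omega)
      rw [show 2 * (m + 1) - (m + 1) = m + 1 by omega] at h
      rw [Nat.centralBinom, eq_div_iff (by positivity), ← mul_assoc]
      rw [show (2 * (m + 1))! = (2 * m + 2) * (2 * m + 1)! from Nat.factorial_succ (2 * m + 1)] at h
      exact_mod_cast h
    simp only [Function.comp]
    rw [show 2 * m + 1 + 1 = 2 * (m + 1) by ring, integral_cos_pow_even, hc, div_pow,
      show (4 : ℝ) ^ (m + 1) = 2 * 2 ^ (2 * m + 1) by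
        rw [show (4 : ℝ) = 2 ^ 2 by norm_num, ← pow_mul]; ring, Nat.factorial_succ m]
    push_cast
    field_simp
  · intro k hk
    obtain ⟨m, rfl | rfl⟩ := Nat.even_or_odd' k
    · rw [integral_cos_pow_odd, mul_zero]
    · exact absurd ⟨m, rfl⟩ hk

/-- The integral `∫₀^π exp (-l (1 - cos x)) (1 + cos x) dx`, equal to `π * G l`. -/
noncomputable def besselIntegral (l : ℝ) : ℝ :=
  ∫ x in (0 : ℝ)..π, Real.exp (-(l * (1 - Real.cos x))) * (1 + Real.cos x)

theorem pi_mul_G (l : ℝ) : π * G l = besselIntegral l := by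
  have h : π * G l = Real.exp (-l) * (π * besselI 0 l + π * besselI 1 l) := by
    rw [G]; ring
  rw [h, besselI_zero_eq, besselI_one_eq, ← intervalIntegral.integral_add
      (Continuous.intervalIntegrable (by fun_prop) _ _)
      (Continuous.intervalIntegrable (by fun_prop) _ _), ← intervalIntegral.integral_const_mul,
      besselIntegral]
  congr 1
  ext x
  rw [show -(l * (1 - Real.cos x)) = -l + l * Real.cos x by ring, Real.exp_add]
  ring

theorem besselIntegral_nonneg (l : ℝ) : 0 ≤ besselIntegral l := by
  apply intervalIntegral.integral_nonneg Real.pi_pos.le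
  intro x _
  have := Real.neg_one_le_cos x
  exact mul_nonneg (Real.exp_pos _).le (by linarith)

theorem G_antitone : Antitone G := by
  intro l m h
  have : besselIntegral m ≤ besselIntegral l := by
    apply intervalIntegral.integral_mono_on Real.pi_pos.le
      (Continuous.intervalIntegrable (by fun_prop) _ _)
      (Continuous.intervalIntegrable (by fun_prop) _ _)
    intro x _
    have h1 := Real.neg_one_le_cos x
    have h2 := Real.cos_le_one x
    apply mul_le_mul_of_nonneg_right _ (by linarith)
    apply Real.exp_le_exp.2
    nlinarith
  rw [← pi_mul_G, ← pi_mul_G] at this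
  exact le_of_mul_le_mul_left this Real.pi_pos

/-- The integral `∫₀^π exp (-l (1 - cos x)) sin² x dx`, minus the derivative of
`besselIntegral`. -/
noncomputable def besselIntegralDeriv (l : ℝ) : ℝ :=
  ∫ x in (0 : ℝ)..π, Real.exp (-(l * (1 - Real.cos x))) * Real.sin x ^ 2

theorem hasDerivAt_besselIntegral (l : ℝ) :
    HasDerivAt besselIntegral (-besselIntegralDeriv l) l := by
  have h := (intervalIntegral.hasDerivAt_integral_of_dominated_loc_of_deriv_le (μ := volume)
    (a := (0 : ℝ)) (b := π) (x₀ := l) (s := Metric.ball l 1)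
    (F := fun l x => Real.exp (-(l * (1 - Real.cos x))) * (1 + Real.cos x))
    (F' := fun l x => -(Real.exp (-(l * (1 - Real.cos x))) * Real.sin x ^ 2))
    (bound := fun _ => Real.exp (2 * (|l| + 1)))
    (Metric.ball_mem_nhds l one_pos)
    (Eventually.of_forall fun y => Continuous.aestronglyMeasurable (by fun_prop))
    (Continuous.intervalIntegrable (by fun_prop) _ _)
    (Continuous.aestronglyMeasurable (by fun_prop))
    (ae_of_all _ fun x _ y hy => by
      have h1 := Real.neg_one_le_cos x
      have h2 := Real.cos_le_one x
      have h3 : |y| ≤ |l| + 1 := by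
        have h4 : |y - l| < 1 := hy
        have h5 := abs_add_le (y - l) l
        rw [sub_add_cancel] at h5
        linarith
      rw [norm_neg, norm_mul, Real.norm_eq_abs, Real.norm_eq_abs, abs_of_pos (Real.exp_pos _),
        abs_of_nonneg (sq_nonneg _)]
      refine (mul_le_of_le_one_right (Real.exp_pos _).le (Real.sin_sq_le_one x)).trans ?_
      apply Real.exp_le_exp.2
      have h6 := neg_abs_le y
      have h7 := abs_nonneg y
      nlinarith)
    intervalIntegrable_const
    (ae_of_all _ fun x _ y _ => by
      have h1 : HasDerivAt (fun y : ℝ => -(y * (1 - Real.cos x))) (-(1 * (1 - Real.cos x))) y :=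
        ((hasDerivAt_id y).mul_const _).neg
      have h2 := h1.exp.mul_const (1 + Real.cos x)
      exact h2.congr_deriv (by rw [Real.sin_sq]; ring))).2
  rw [intervalIntegral.integral_neg] at h
  exact h

/-- Integrate the derivative of `exp (-(l * (1 - cos x))) * sin x`, which vanishes at both
endpoints. -/
theorem mul_besselIntegralDeriv (l : ℝ) :
    l * besselIntegralDeriv l
      = ∫ x in (0 : ℝ)..π, Real.exp (-(l * (1 - Real.cos x))) * Real.cos x := by
  have hd (x : ℝ) : HasDerivAt (fun x => Real.exp (-(l * (1 - Real.cos x))) * Real.sin x)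
      (Real.exp (-(l * (1 - Real.cos x))) * Real.cos x
        - l * (Real.exp (-(l * (1 - Real.cos x))) * Real.sin x ^ 2)) x := by
    have h1 : HasDerivAt (fun x : ℝ => -(l * (1 - Real.cos x))) (-(l * (- -Real.sin x))) x :=
      (((Real.hasDerivAt_cos x).const_sub 1).const_mul l).neg
    exact (h1.exp.mul (Real.hasDerivAt_sin x)).congr_deriv (by ring)
  have h := intervalIntegral.integral_eq_sub_of_hasDerivAt (a := 0) (b := π) (fun x _ => hd x)
    (Continuous.intervalIntegrable (by fun_prop) _ _)
  rw [intervalIntegral.integral_sub (Continuous.intervalIntegrable (by fun_prop) _ _)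
    (Continuous.intervalIntegrable (by fun_prop) _ _), intervalIntegral.integral_const_mul] at h
  simp only [Real.sin_pi, Real.sin_zero, mul_zero, sub_zero] at h
  rw [besselIntegralDeriv]
  linarith

/-- The left side carries the sign of the derivative of `(c + l) * besselIntegral l ^ 2`. The factor
`1 - 2 * c * (1 + cos x)` shows the role of the two constants: `c = 1/4` is the largest value that
keeps it nonnegative, and for `c = 1` the integral vanishes at `l = 0`. -/
theorem besselIntegral_sub (l c : ℝ) :
    besselIntegral l - 2 * (c + l) * besselIntegralDeriv l
      = ∫ x in (0 : ℝ)..π, Real.exp (-(l * (1 - Real.cos x)))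
          * ((1 - Real.cos x) * (1 - 2 * c * (1 + Real.cos x))) := by
  have h : besselIntegral l - 2 * (c + l) * besselIntegralDeriv l
      = besselIntegral l - 2 * c * besselIntegralDeriv l
        - 2 * ∫ x in (0 : ℝ)..π, Real.exp (-(l * (1 - Real.cos x))) * Real.cos x := by
    rw [← mul_besselIntegralDeriv]; ring
  rw [h, besselIntegral, besselIntegralDeriv, ← intervalIntegral.integral_const_mul,
    ← intervalIntegral.integral_const_mul,
    ← intervalIntegral.integral_sub (Continuous.intervalIntegrable (by fun_prop) _ _)
    (Continuous.intervalIntegrable (by fun_prop) _ _),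
    ← intervalIntegral.integral_sub (Continuous.intervalIntegrable (by fun_prop) _ _)
    (Continuous.intervalIntegrable (by fun_prop) _ _)]
  congr 1
  ext x
  rw [Real.sin_sq]
  ring

theorem two_mul_besselIntegralDeriv_le (l : ℝ) :
    2 * (1 / 4 + l) * besselIntegralDeriv l ≤ besselIntegral l := by
  rw [← sub_nonneg, besselIntegral_sub]
  apply intervalIntegral.integral_nonneg Real.pi_pos.le
  intro x _
  have h1 := Real.neg_one_le_cos x
  have h2 := Real.cos_le_one x
  exact mul_nonneg (Real.exp_pos _).le (mul_nonneg (by linarith) (by linarith))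

theorem besselIntegral_le {l : ℝ} (hl : 0 ≤ l) :
    besselIntegral l ≤ 2 * (1 + l) * besselIntegralDeriv l := by
  rw [← sub_nonpos, besselIntegral_sub]
  -- The second factor changes sign once, at `cos x = -1/2`, where `1 - cos x = 3/2`. Freezing the
  -- decreasing exponential at its value there can only increase the integral, and the frozen
  -- integral is zero.
  have h0 : ∫ x in (0 : ℝ)..π, Real.exp (-(l * (3 / 2)))
      * ((1 - Real.cos x) * (1 - 2 * 1 * (1 + Real.cos x))) = 0 := by
    rw [intervalIntegral.integral_const_mul]
    have h : ∫ x in (0 : ℝ)..π, (1 - Real.cos x) * (1 - 2 * 1 * (1 + Real.cos x))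
        = ∫ x in (0 : ℝ)..π, (2 * Real.cos x ^ 2 - Real.cos x - 1) := by
      congr 1
      ext x
      ring
    rw [h, intervalIntegral.integral_sub (Continuous.intervalIntegrable (by fun_prop) _ _)
      (Continuous.intervalIntegrable (by fun_prop) _ _),
      intervalIntegral.integral_sub (Continuous.intervalIntegrable (by fun_prop) _ _)
      (Continuous.intervalIntegrable (by fun_prop) _ _), intervalIntegral.integral_const_mul,
      integral_cos_sq]
    simp
    ring
  refine le_of_le_of_eq ?_ h0
  apply intervalIntegral.integral_mono_on Real.pi_pos.le
    (Continuous.intervalIntegrable (by fun_prop) _ _)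
    (Continuous.intervalIntegrable (by fun_prop) _ _)
  intro x _
  have h1 := Real.neg_one_le_cos x
  have h2 := Real.cos_le_one x
  rcases le_total (-(1 / 2)) (Real.cos x) with h | h
  · apply mul_le_mul_of_nonpos_right
    · apply Real.exp_le_exp.2
      nlinarith
    · exact mul_nonpos_of_nonneg_of_nonpos (by linarith) (by linarith)
  · apply mul_le_mul_of_nonneg_right
    · apply Real.exp_le_exp.2
      nlinarith
    · exact mul_nonneg (by linarith) (by linarith)

theorem hasDerivAt_add_mul_sq_besselIntegral (c l : ℝ) :
    HasDerivAt (fun l => (c + l) * besselIntegral l ^ 2)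
      (besselIntegral l * (besselIntegral l - 2 * (c + l) * besselIntegralDeriv l)) l := by
  exact (((hasDerivAt_id l).const_add c).mul ((hasDerivAt_besselIntegral l).pow 2)).congr_deriv
    (by simp; ring)

theorem monotone_add_mul_sq_besselIntegral :
    Monotone fun l => (1 / 4 + l) * besselIntegral l ^ 2 := by
  apply monotone_of_deriv_nonneg
  · exact fun l => (hasDerivAt_add_mul_sq_besselIntegral _ l).differentiableAt
  · intro l
    rw [(hasDerivAt_add_mul_sq_besselIntegral _ l).deriv]
    exact mul_nonneg (besselIntegral_nonneg l)
      (sub_nonneg.2 (two_mul_besselIntegralDeriv_le l))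

theorem antitoneOn_add_mul_sq_besselIntegral :
    AntitoneOn (fun l => (1 + l) * besselIntegral l ^ 2) (Set.Ici 0) := by
  apply antitoneOn_of_deriv_nonpos (convex_Ici 0)
  · exact fun l _ => (hasDerivAt_add_mul_sq_besselIntegral _ l).continuousAt.continuousWithinAt
  · exact fun l _ => (hasDerivAt_add_mul_sq_besselIntegral _ l).differentiableAt.differentiableWithinAt
  · intro l hl
    rw [interior_Ici] at hl
    rw [(hasDerivAt_add_mul_sq_besselIntegral _ l).deriv]
    exact mul_nonpos_of_nonneg_of_nonpos (besselIntegral_nonneg l)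
      (sub_nonpos.2 (besselIntegral_le (le_of_lt hl)))

/-- With `v = 2 * sin (x / 2)` one has `1 - cos x = v ^ 2 / 2`, and `1 + cos x = 2 * cos (x / 2) ^ 2
≤ 2 * cos (x / 2)`. The integral is therefore at most twice a half-line Gaussian integral. -/
theorem mul_sq_besselIntegral_le {l : ℝ} (hl : 0 < l) : l * besselIntegral l ^ 2 ≤ 2 * π := by
  have h1 : besselIntegral l ≤ 2 * ∫ x in (0 : ℝ)..π,
      (fun v => Real.exp (-(l / 2) * v ^ 2)) (2 * Real.sin (x / 2)) * Real.cos (x / 2) := by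
    rw [← intervalIntegral.integral_const_mul]
    apply intervalIntegral.integral_mono_on Real.pi_pos.le
      (Continuous.intervalIntegrable (by fun_prop) _ _)
      (Continuous.intervalIntegrable (by fun_prop) _ _)
    intro x hx
    have hc : Real.cos x = 2 * Real.cos (x / 2) ^ 2 - 1 := by
      rw [← Real.cos_two_mul]; ring_nf
    have hs : -(l / 2) * (2 * Real.sin (x / 2)) ^ 2 = -(l * (1 - Real.cos x)) := by
      rw [hc, mul_pow, Real.sin_sq]; ring
    have h0 : 0 ≤ Real.cos (x / 2) :=
      Real.cos_nonneg_of_neg_pi_div_two_le_of_le (by linarith [hx.1, Real.pi_pos])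
        (by linarith [hx.2])
    have h1 := Real.cos_le_one (x / 2)
    simp only [hs]
    rw [show ∀ a b : ℝ, 2 * (a * b) = a * (2 * b) by intros; ring]
    apply mul_le_mul_of_nonneg_left _ (Real.exp_pos _).le
    rw [hc]
    nlinarith
  have h2 : ∫ x in (0 : ℝ)..π,
      (fun v => Real.exp (-(l / 2) * v ^ 2)) (2 * Real.sin (x / 2)) * Real.cos (x / 2)
      = ∫ v in (0 : ℝ)..2, Real.exp (-(l / 2) * v ^ 2) := by
    have h := intervalIntegral.integral_comp_mul_deriv (a := 0) (b := π)
      (f := fun x => 2 * Real.sin (x / 2)) (f' := fun x => Real.cos (x / 2))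
      (g := fun v => Real.exp (-(l / 2) * v ^ 2)) (fun x _ => by
        have := (((hasDerivAt_id x).div_const 2).sin).const_mul 2
        exact this.congr_deriv (by simp; ring)) (by fun_prop) (by fun_prop)
    simpa using h
  have h3 : ∫ v in (0 : ℝ)..2, Real.exp (-(l / 2) * v ^ 2) ≤ √(π / (l / 2)) / 2 := by
    rw [← integral_gaussian_Ioi, intervalIntegral.integral_of_le zero_le_two]
    apply setIntegral_mono_set (integrable_exp_neg_mul_sq (half_pos hl)).integrableOn
    · exact ae_of_all _ fun x => (Real.exp_pos _).le
    · exact (Set.Ioc_subset_Ioi_self).eventuallyLE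
  have h4 : besselIntegral l ≤ √(π / (l / 2)) := by
    rw [h2] at h1
    linarith
  calc l * besselIntegral l ^ 2 ≤ l * √(π / (l / 2)) ^ 2 := by
        gcongr
        exact besselIntegral_nonneg l
    _ = 2 * π := by
        rw [Real.sq_sqrt (by positivity)]
        field_simp

theorem add_mul_sq_G_le (l : ℝ) : (1 / 4 + l) * G l ^ 2 ≤ 2 / π := by
  have h : (1 / 4 + l) * besselIntegral l ^ 2 ≤ 2 * π := by
    have ht : Tendsto (fun m : ℝ => 1 / 4 * (2 * π / m) + 2 * π) atTop
        (𝓝 (1 / 4 * 0 + 2 * π)) :=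
      (((tendsto_const_nhds).div_atTop tendsto_id).const_mul _).add_const _
    rw [mul_zero, zero_add] at ht
    apply ge_of_tendsto ht
    filter_upwards [eventually_ge_atTop l, eventually_gt_atTop 0] with m hm hm0
    refine (monotone_add_mul_sq_besselIntegral hm).trans ?_
    have h1 := mul_sq_besselIntegral_le hm0
    have h2 : besselIntegral m ^ 2 ≤ 2 * π / m := by
      rw [le_div_iff₀ hm0]; linarith
    simp only
    linarith
  rw [← pi_mul_G] at h
  rw [le_div_iff₀ Real.pi_pos]
  have := Real.pi_pos
  nlinarith

theorem one_add_mul_sq_G_le {l : ℝ} (hl : 0 ≤ l) : (1 + l) * G l ^ 2 ≤ 1 := by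
  have h := antitoneOn_add_mul_sq_besselIntegral (Set.self_mem_Ici) hl hl
  have h0 : besselIntegral 0 = π := by
    rw [besselIntegral]
    simp
  simp only [h0, add_zero, one_mul] at h
  rw [← pi_mul_G] at h
  have := Real.pi_pos
  have h2 : (1 + l) * G l ^ 2 * π ^ 2 ≤ 1 * π ^ 2 := by linarith
  exact le_of_mul_le_mul_right h2 (by positivity)

theorem le_mul_rpow_neg_half {a b c : ℝ} (hb : 0 ≤ b) (hc : 0 < c) (h : c * a ^ 2 ≤ b) :
    a ≤ √b * c ^ (-(1 / 2) : ℝ) := by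
  rw [Real.rpow_neg hc.le, ← Real.sqrt_eq_rpow, ← div_eq_mul_inv, ← Real.sqrt_div hb]
  apply Real.le_sqrt_of_sq_le
  rw [le_div_iff₀ hc]
  linarith

theorem G_le_sqrt_mul_rpow {l : ℝ} (hl : 0 ≤ l) :
    G l ≤ √(2 / π) * (1 / 4 + l) ^ (-(1 / 2) : ℝ) :=
  le_mul_rpow_neg_half (by positivity) (by positivity) (add_mul_sq_G_le l)

theorem G_le_rpow {l : ℝ} (hl : 0 ≤ l) : G l ≤ (1 + l) ^ (-(1 / 2) : ℝ) := by
  have h := le_mul_rpow_neg_half zero_le_one (by positivity) (one_add_mul_sq_G_le hl)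
  simpa using h

end BesselIntegral

end Concentration

namespace Concentration

open scoped Real Topology

/-! ### The level-set inequality behind Kanter's bound -/

section CosineMass

/-- The mass `∫ (1 + cos x) dx` of `{x ∈ [0, π] | 1 - cos x ≤ d}`. -/
noncomputable def cosMass (d : ℝ) : ℝ := Real.arccos (1 - d) + √(1 - (1 - d) ^ 2)

theorem cosMass_two : cosMass 2 = π := by
  norm_num [cosMass]

theorem continuous_cosMass : Continuous cosMass := by
  unfold cosMass
  fun_prop

theorem hasDerivAt_cosMass {d : ℝ} (h0 : 0 < d) (h2 : d < 2) :
    HasDerivAt cosMass (√((2 - d) / d)) d := by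
  have hpos : 0 < 1 - (1 - d) ^ 2 := by nlinarith
  have h1 : HasDerivAt (fun d : ℝ => 1 - d) (-1) d := by
    simpa using (hasDerivAt_id d).const_sub 1
  have h3 := (Real.hasDerivAt_arccos (x := 1 - d) (by linarith) (by linarith)).comp d h1
  have h4 : HasDerivAt (fun d : ℝ => √(1 - (1 - d) ^ 2))
      (-(2 * (1 - d) * -1) / (2 * √(1 - (1 - d) ^ 2))) d := by
    have h := ((h1.pow 2).const_sub 1).sqrt hpos.ne'
    exact h.congr_deriv (by simp)
  refine (h3.add h4).congr_deriv ?_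
  have hs : 0 < √(1 - (1 - d) ^ 2) := Real.sqrt_pos.2 hpos
  have h5 : √((2 - d) / d) = (2 - d) / √(1 - (1 - d) ^ 2) := by
    rw [show (2 - d) / d = (2 - d) ^ 2 / (1 - (1 - d) ^ 2) by
      rw [div_eq_div_iff h0.ne' hpos.ne']; ring, Real.sqrt_div (sq_nonneg _),
      Real.sqrt_sq (by linarith)]
  rw [h5]
  field_simp
  ring

theorem monotoneOn_cosMass : MonotoneOn cosMass (Set.Icc 0 2) := by
  apply monotoneOn_of_deriv_nonneg (convex_Icc 0 2) continuous_cosMass.continuousOn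
  · intro d hd
    rw [interior_Icc] at hd
    exact (hasDerivAt_cosMass hd.1 hd.2).differentiableAt.differentiableWithinAt
  · intro d hd
    rw [interior_Icc] at hd
    rw [(hasDerivAt_cosMass hd.1 hd.2).deriv]
    positivity

/-- The density `√((2 - d) / d)` of `cosMass` decreases, so among subintervals of `[0, 2]` of given
length the rightmost has the least mass. -/
theorem pi_sub_cosMass_le {a b : ℝ} (ha : 0 ≤ a) (hab : a ≤ b) (hb : b ≤ 2) :
    π - cosMass (2 - (b - a)) ≤ cosMass b - cosMass a := by
  have hanti : AntitoneOn (fun x => cosMass (x + (b - a)) - cosMass x)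
      (Set.Icc 0 (2 - (b - a))) := by
    have hderiv {x : ℝ} (hx : x ∈ Set.Ioo 0 (2 - (b - a))) :
        HasDerivAt (fun x => cosMass (x + (b - a)) - cosMass x)
          (√((2 - (x + (b - a))) / (x + (b - a))) - √((2 - x) / x)) x := by
      have h1 := (hasDerivAt_cosMass (d := x + (b - a)) (by linarith [hx.1]) (by linarith [hx.2]))
      exact (h1.comp_add_const x (b - a)).sub (hasDerivAt_cosMass hx.1 (by linarith [hx.2]))
    apply antitoneOn_of_deriv_nonpos (convex_Icc _ _)
    · exact ((continuous_cosMass.comp (continuous_id.add continuous_const)).sub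
        continuous_cosMass).continuousOn
    · intro x hx
      rw [interior_Icc] at hx
      exact (hderiv hx).differentiableAt.differentiableWithinAt
    · intro x hx
      rw [interior_Icc] at hx
      rw [(hderiv hx).deriv, sub_nonpos]
      have := hx.1
      have := hx.2
      apply Real.sqrt_le_sqrt
      rw [div_le_div_iff₀ (by linarith) (by linarith)]
      nlinarith
  have h := hanti (a := a) (b := 2 - (b - a)) ⟨ha, by linarith⟩ ⟨by linarith, le_rfl⟩ (by linarith)
  simp only [sub_add_cancel, add_sub_cancel, cosMass_two] at h
  exact h

theorem four_mul_sub_le {s x : ℝ} (hs : 0 ≤ s) (hs' : s ≤ 8 / 5) (hsx : s ≤ x)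
    (hxs : x ≤ 2 * s) : 4 * (x - s) ≤ (2 - s) * (Real.exp x - 1) := by
  have hx : 0 ≤ x := hs.trans hsx
  have hexp : 1 + x + x ^ 2 / 2 + x ^ 3 / 6 + x ^ 4 / 24 ≤ Real.exp x := by
    have h := Real.sum_le_exp_of_nonneg hx 5
    norm_num [Finset.sum_range_succ, Nat.factorial] at h
    linarith
  set P := x + x ^ 2 / 2 + x ^ 3 / 6 + x ^ 4 / 24 with hP
  have hP0 : 0 ≤ P := by positivity
  suffices h : 4 * (x - s) ≤ (2 - s) * P by
    have h2 : (2 - s) * P ≤ (2 - s) * (Real.exp x - 1) :=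
      mul_le_mul_of_nonneg_left (by linarith) (by linarith)
    linarith
  -- The inequality is affine in `s`. For `P ≤ 4` its worst case is the smallest `s`, namely `x /
  -- 2`; for `P ≥ 4` it is the largest, the smaller of `x` and `8 / 5`.
  rcases le_total P 4 with h4 | h4
  · have h1 : 2 * x ≤ (2 - x / 2) * P := by
      have h3 : (2 - x / 2) * P - 2 * x = x / 48 * (24 * x + 4 * x ^ 2 - x ^ 4) := by
        rw [hP]; ring
      have h5 : x ^ 4 ≤ 24 * x + 4 * x ^ 2 := by
        have h6 : x ≤ 16 / 5 := by linarith
        have h7 : x * x ≤ 16 / 5 * x := by nlinarith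
        have h8 : x ^ 2 * (x * x) ≤ x ^ 2 * (16 / 5 * x) :=
          mul_le_mul_of_nonneg_left h7 (sq_nonneg x)
        have h9 : x ^ 2 * x ≤ 16 / 5 * x * x := by nlinarith
        nlinarith
      have h6 : 0 ≤ x / 48 * (24 * x + 4 * x ^ 2 - x ^ 4) :=
        mul_nonneg (by positivity) (by linarith)
      linarith
    nlinarith
  · rcases le_total x (8 / 5) with h8 | h8
    · nlinarith
    · have h1 : 4 * (x - 8 / 5) ≤ (2 - 8 / 5) * P := by
        rw [hP]
        nlinarith [sq_nonneg (x - 2), sq_nonneg (x ^ 2 - 4), mul_nonneg hx (sq_nonneg (x - 2)),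
          sq_nonneg (x - 5 / 2)]
      nlinarith

/-- After squaring, the cross term is bounded by `(q - e ^ 2) / (1 - e ^ 2)`, the slack being `e ^ 2
* (q - 1) ^ 2`. The terms in `e ^ 2` in the numerators then cancel. -/
theorem sqrt_add_sqrt_le {q e : ℝ} (he : 0 < e) (heq : e < q) (hq : q ≤ 1) :
    e * (√((q + e) / (1 - e)) + √((q - e) / (1 + e))) ≤ √(4 * q / ((e ^ 2)⁻¹ - 1)) := by
  have he1 : 0 < 1 - e := by linarith
  have he2 : 0 < 1 - e ^ 2 := by nlinarith
  have hA : 0 ≤ (q + e) / (1 - e) := div_nonneg (by linarith) he1.le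
  have hB : 0 ≤ (q - e) / (1 + e) := div_nonneg (by linarith) (by linarith)
  apply Real.le_sqrt_of_sq_le
  have hAB : √((q + e) / (1 - e)) * √((q - e) / (1 + e)) ≤ (q - e ^ 2) / (1 - e ^ 2) := by
    rw [← Real.sqrt_mul hA]
    apply Real.sqrt_le_iff.2 ⟨div_nonneg (by nlinarith) he2.le, ?_⟩
    rw [div_mul_div_comm, div_pow, div_le_div_iff₀ (by nlinarith) (by positivity)]
    have h1 : (q + e) * (q - e) * (1 - e ^ 2) ≤ (q - e ^ 2) ^ 2 := by
      nlinarith [mul_nonneg (sq_nonneg e) (sq_nonneg (q - 1))]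
    have h2 := mul_le_mul_of_nonneg_right h1 he2.le
    nlinarith
  have hsum : (q + e) / (1 - e) + (q - e) / (1 + e) = (2 * q + 2 * e ^ 2) / (1 - e ^ 2) := by
    rw [div_add_div _ _ he1.ne' (by linarith), show (1 - e) * (1 + e) = 1 - e ^ 2 by ring]
    ring
  have hR : 4 * q / ((e ^ 2)⁻¹ - 1) = e ^ 2 * (4 * q / (1 - e ^ 2)) := by
    rw [show (e ^ 2)⁻¹ - 1 = (1 - e ^ 2) / e ^ 2 by field_simp]
    field_simp
  rw [hR, mul_pow]
  apply mul_le_mul_of_nonneg_left _ (sq_nonneg e)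
  rw [add_sq, Real.sq_sqrt hA, Real.sq_sqrt hB]
  calc _ = ((q + e) / (1 - e) + (q - e) / (1 + e))
        + 2 * (√((q + e) / (1 - e)) * √((q - e) / (1 + e))) := by ring
    _ ≤ (2 * q + 2 * e ^ 2) / (1 - e ^ 2) + 2 * ((q - e ^ 2) / (1 - e ^ 2)) := by
        rw [hsum]; linarith
    _ = 4 * q / (1 - e ^ 2) := by field_simp; ring

/-- The right side minus the left side, up to the constant `π`, increases in `s` from the level at
which the upper cap is empty. Its derivative is nonnegative by `sqrt_add_sqrt_le` with `q = 2 * p -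
1` and `e = exp (-(p * u))`, followed by `four_mul_sub_le` with `x = 2 * p * u`. -/
theorem cosMass_level_le_of_le {p s : ℝ} (hp : 1 / 2 ≤ p) (hp1 : p ≤ 1) (hs' : s ≤ 8 / 5)
    (he : Real.exp (-(p * s)) ≤ 2 * p - 1) :
    cosMass ((1 - Real.exp (-(p * s))) / p) + π - cosMass ((1 + Real.exp (-(p * s))) / p)
      ≤ cosMass s := by
  have hp0 : 0 < p := by linarith
  have hq0 : 0 < 2 * p - 1 := (Real.exp_pos _).trans_le he
  -- At `s₁` the upper threshold `(1 + exp (-(p * s₁))) / p` equals `2`, so the upper cap has no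
  -- mass and only `1 - exp (-y) ≤ y` is needed.
  set s₁ := -Real.log (2 * p - 1) / p with hs₁
  have hexp₁ : Real.exp (-(p * s₁)) = 2 * p - 1 := by
    rw [hs₁, mul_div_cancel₀ _ hp0.ne', neg_neg, Real.exp_log hq0]
  have hs₁0 : 0 ≤ s₁ := by
    apply div_nonneg _ hp0.le
    rw [neg_nonneg]
    exact Real.log_nonpos hq0.le (by linarith)
  have hs₁s : s₁ ≤ s := by
    rw [← hexp₁, Real.exp_le_exp, neg_le_neg_iff] at he
    exact le_of_mul_le_mul_left he hp0
  have hmono : MonotoneOn (fun u => cosMass u - cosMass ((1 - Real.exp (-(p * u))) / p)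
      + cosMass ((1 + Real.exp (-(p * u))) / p)) (Set.Icc s₁ s) := by
    have hderiv {u : ℝ} (hu : u ∈ Set.Ioo s₁ s) :
        HasDerivAt (fun u => cosMass u - cosMass ((1 - Real.exp (-(p * u))) / p)
          + cosMass ((1 + Real.exp (-(p * u))) / p))
          (√((2 - u) / u) - Real.exp (-(p * u)) *
            (√((2 * p - 1 + Real.exp (-(p * u))) / (1 - Real.exp (-(p * u))))
              + √((2 * p - 1 - Real.exp (-(p * u))) / (1 + Real.exp (-(p * u)))))) u := by
      have hu0 : 0 < u := hs₁0.trans_lt hu.1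
      have hlt : Real.exp (-(p * u)) < 2 * p - 1 := by
        rw [← hexp₁, Real.exp_lt_exp, neg_lt_neg_iff]
        exact mul_lt_mul_of_pos_left hu.1 hp0
      have hepos := Real.exp_pos (-(p * u))
      have hexp : HasDerivAt (fun u => Real.exp (-(p * u))) (Real.exp (-(p * u)) * -(p * 1)) u :=
        (((hasDerivAt_id u).const_mul p).neg).exp
      have h1 := (hexp.const_sub 1).div_const p
      have h2 := (hexp.const_add 1).div_const p
      have hW1 := hasDerivAt_cosMass (d := (1 - Real.exp (-(p * u))) / p)
        (div_pos (by linarith) hp0) (by rw [div_lt_iff₀ hp0]; linarith)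
      have hW2 := hasDerivAt_cosMass (d := (1 + Real.exp (-(p * u))) / p)
        (div_pos (by linarith) hp0) (by rw [div_lt_iff₀ hp0]; linarith)
      have hW := hasDerivAt_cosMass hu0 (by linarith [hu.2])
      refine ((hW.sub (hW1.comp u h1)).add (hW2.comp u h2)).congr_deriv ?_
      have e1 : (2 - (1 - Real.exp (-(p * u))) / p) / ((1 - Real.exp (-(p * u))) / p)
          = (2 * p - 1 + Real.exp (-(p * u))) / (1 - Real.exp (-(p * u))) := by
        field_simp
        ring
      have e2 : (2 - (1 + Real.exp (-(p * u))) / p) / ((1 + Real.exp (-(p * u))) / p)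
          = (2 * p - 1 - Real.exp (-(p * u))) / (1 + Real.exp (-(p * u))) := by
        field_simp
        ring
      rw [e1, e2]
      field_simp
      ring
    apply monotoneOn_of_deriv_nonneg (convex_Icc _ _)
    · apply Continuous.continuousOn
      have := continuous_cosMass
      fun_prop
    · intro u hu
      rw [interior_Icc] at hu
      exact (hderiv hu).differentiableAt.differentiableWithinAt
    · intro u hu
      rw [interior_Icc] at hu
      rw [(hderiv hu).deriv, sub_nonneg]
      have hu0 : 0 < u := hs₁0.trans_lt hu.1
      have hlt : Real.exp (-(p * u)) < 2 * p - 1 := by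
        rw [← hexp₁, Real.exp_lt_exp, neg_lt_neg_iff]
        exact mul_lt_mul_of_pos_left hu.1 hp0
      refine (sqrt_add_sqrt_le (Real.exp_pos _) hlt (by linarith)).trans ?_
      apply Real.sqrt_le_sqrt
      have hinv : (Real.exp (-(p * u)) ^ 2)⁻¹ = Real.exp (2 * p * u) := by
        rw [← Real.exp_nat_mul, ← Real.exp_neg]
        congr 1
        push_cast
        ring
      have h := four_mul_sub_le (x := 2 * p * u) hu0.le (by linarith [hu.2]) (by nlinarith)
        (by nlinarith)
      rw [hinv, div_le_div_iff₀ _ hu0]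
      · linarith
      · have : 0 < 2 * p * u := by positivity
        linarith [Real.add_one_lt_exp this.ne']
  have h := hmono ⟨le_rfl, hs₁s⟩ ⟨hs₁s, le_rfl⟩ hs₁s
  have h2 : (1 + (2 * p - 1)) / p = 2 := by field_simp; ring
  have h1 : cosMass ((1 - (2 * p - 1)) / p) ≤ cosMass s₁ := by
    have hle : (1 - Real.exp (-(p * s₁))) / p ≤ s₁ := by
      rw [div_le_iff₀ hp0]
      linarith [Real.add_one_le_exp (-(p * s₁))]
    rw [hexp₁] at hle
    exact monotoneOn_cosMass ⟨div_nonneg (by linarith) hp0.le, by linarith⟩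
      ⟨hs₁0, by linarith⟩ hle
  simp only [hexp₁, h2, cosMass_two] at h
  linarith

/-- For `s ≥ 8 / 5` a cruder argument works: push the gap between the two caps to the right end by
`pi_sub_cosMass_le`, then check that what remains on the left ends before `s`. -/
theorem cosMass_level_le {p s : ℝ} (hp : 1 / 2 ≤ p) (hp1 : p ≤ 1) (hs2 : s ≤ 2)
    (he : Real.exp (-(p * s)) ≤ 2 * p - 1) :
    cosMass ((1 - Real.exp (-(p * s))) / p) + π - cosMass ((1 + Real.exp (-(p * s))) / p)
      ≤ cosMass s := by
  rcases le_total s (8 / 5) with hs' | hs'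
  · exact cosMass_level_le_of_le hp hp1 hs' he
  have hp0 : 0 < p := by linarith
  have hepos := Real.exp_pos (-(p * s))
  have h := pi_sub_cosMass_le (a := (1 - Real.exp (-(p * s))) / p)
    (b := (1 + Real.exp (-(p * s))) / p) (div_nonneg (by linarith) hp0.le)
    (by gcongr; linarith) (by rw [div_le_iff₀ hp0]; linarith)
  have hdiff : (1 + Real.exp (-(p * s))) / p - (1 - Real.exp (-(p * s))) / p
      = 2 * Real.exp (-(p * s)) / p := by ring
  rw [hdiff] at h
  have hle : 2 - 2 * Real.exp (-(p * s)) / p ≤ s := by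
    have h1 : Real.exp (-s) ≤ Real.exp (-(p * s)) := by
      apply Real.exp_le_exp.2
      nlinarith
    have h2 : 2 * Real.exp (-(p * s)) ≤ 2 * Real.exp (-(p * s)) / p := by
      rw [le_div_iff₀ hp0]
      nlinarith
    -- This is where `8 / 5` comes from: at that point the claim reads `exp 8 ≤ 5 ^ 5`, which holds
    -- narrowly. Beyond it, the tangent bound for `exp` at `-(8 / 5)` suffices.
    have h3 : 1 - s / 2 ≤ Real.exp (-s) := by
      have h85 : (1 / 5 : ℝ) ≤ Real.exp (-(8 / 5)) := by
        rw [Real.exp_neg, one_div]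
        apply inv_anti₀ (Real.exp_pos _)
        have h4 : Real.exp (8 / 5) ^ 5 = Real.exp 1 ^ 8 := by
          rw [← Real.exp_nat_mul, ← Real.exp_nat_mul]
          norm_num
        have h5 : Real.exp 1 ^ 8 ≤ 5 ^ 5 := by
          calc Real.exp 1 ^ 8 ≤ 2.7182818286 ^ 8 := by
                gcongr
                exact Real.exp_one_lt_d9.le
            _ ≤ 5 ^ 5 := by norm_num
        rw [← h4] at h5
        exact le_of_pow_le_pow_left₀ (by norm_num) (by norm_num) h5
      have h6 : Real.exp (-s) = Real.exp (-(8 / 5)) * Real.exp (8 / 5 - s) := by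
        rw [← Real.exp_add]
        ring_nf
      have h7 := Real.add_one_le_exp (8 / 5 - s)
      rw [h6]
      nlinarith
    linarith
  have hmono := monotoneOn_cosMass (a := 2 - 2 * Real.exp (-(p * s)) / p) (b := s)
    ⟨by rw [sub_nonneg, div_le_iff₀ hp0]; linarith, by linarith⟩ ⟨by linarith, hs2⟩ hle
  linarith

end CosineMass

/-! ### Layer cake, Hölder and Kanter's inequality -/

section Kanter

/-- The measure with density `1 + cos x` on `(0, π]`. -/
noncomputable def cosMeasure : Measure ℝ :=
  (volume.restrict (Set.Ioc 0 π)).withDensity fun x => ENNReal.ofReal (1 + Real.cos x)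

theorem lintegral_cosMeasure {f : ℝ → ℝ} (hf : Continuous f) (h0 : ∀ x, 0 ≤ f x) :
    ∫⁻ x, ENNReal.ofReal (f x) ∂cosMeasure
      = ENNReal.ofReal (∫ x in (0 : ℝ)..π, f x * (1 + Real.cos x)) := by
  have hc (x : ℝ) : 0 ≤ 1 + Real.cos x := by linarith [Real.neg_one_le_cos x]
  rw [cosMeasure, lintegral_withDensity_eq_lintegral_mul _ (by fun_prop) (by fun_prop),
    intervalIntegral.integral_of_le Real.pi_pos.le, ofReal_integral_eq_lintegral_ofReal]
  · congr 1
    ext x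
    rw [Pi.mul_apply, ← ENNReal.ofReal_mul (hc x), mul_comm]
  · exact ((by fun_prop : Continuous fun x => f x * (1 + Real.cos x)).integrableOn_Icc).mono_set
      Set.Ioc_subset_Icc_self
  · exact ae_of_all _ fun x => mul_nonneg (h0 x) (hc x)

theorem cosMeasure_Ioc {a b : ℝ} (ha : 0 ≤ a) (hab : a ≤ b) (hb : b ≤ π) :
    cosMeasure (Set.Ioc a b) = ENNReal.ofReal (b + Real.sin b - (a + Real.sin a)) := by
  rw [cosMeasure, withDensity_apply _ measurableSet_Ioc, Measure.restrict_restrict measurableSet_Ioc,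
    Set.inter_eq_left.2 (Set.Ioc_subset_Ioc ha hb), ← ofReal_integral_eq_lintegral_ofReal,
    ← intervalIntegral.integral_of_le hab]
  · congr 1
    rw [intervalIntegral.integral_add (Continuous.intervalIntegrable (by fun_prop) _ _)
      (Continuous.intervalIntegrable (by fun_prop) _ _)]
    simp
    ring
  · exact ((by fun_prop : Continuous fun x => 1 + Real.cos x).integrableOn_Icc).mono_set
      Set.Ioc_subset_Icc_self
  · exact ae_of_all _ fun x => by
      have := Real.neg_one_le_cos x
      simp only [Pi.zero_apply]
      linarith

theorem cosMeasure_Ioo (a b : ℝ) : cosMeasure (Set.Ioo a b) = cosMeasure (Set.Ioc a b) := by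
  have h : cosMeasure ≪ volume :=
    (withDensity_absolutelyContinuous _ _).trans Measure.absolutelyContinuous_restrict
  exact measure_congr (h.ae_eq Ioo_ae_eq_Ioc)

theorem cosMeasure_compl : cosMeasure (Set.Ioc 0 π)ᶜ = 0 := by
  have h : cosMeasure ≪ volume.restrict (Set.Ioc 0 π) := withDensity_absolutelyContinuous _ _
  apply h
  rw [Measure.restrict_apply measurableSet_Ioc.compl]
  simp

theorem cosMass_eq (d : ℝ) :
    cosMass d = Real.arccos (1 - d) + Real.sin (Real.arccos (1 - d)) := by
  rw [cosMass, Real.sin_arccos]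

theorem ofReal_cosMass_le {s : ℝ} (hs : 0 < s) :
    ENNReal.ofReal (cosMass s) ≤ cosMeasure {x | 1 - Real.cos x < s} := by
  have h := cosMeasure_Ioc le_rfl (Real.arccos_nonneg (1 - s)) (Real.arccos_le_pi _)
  rw [Real.sin_zero, add_zero, sub_zero, ← cosMass_eq, ← cosMeasure_Ioo] at h
  rw [← h]
  apply measure_mono
  intro x hx
  have hcos : Real.cos (Real.arccos (1 - s)) < Real.cos x :=
    Real.cos_lt_cos_of_nonneg_of_le_pi hx.1.le (Real.arccos_le_pi _) hx.2
  have hle : 1 - s ≤ Real.cos (Real.arccos (1 - s)) := by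
    rcases le_total (-1) (1 - s) with h1 | h1
    · rw [Real.cos_arccos h1 (by linarith)]
    · exact h1.trans (Real.neg_one_le_cos _)
  show 1 - Real.cos x < s
  linarith

theorem cosMeasure_level_le {p s : ℝ} (hp0 : 0 < p) (hp1 : p ≤ 1) (hs : 0 < s) :
    cosMeasure {x | Real.exp (-(p * s)) < |1 - p * (1 - Real.cos x)|}
      ≤ cosMeasure {x | 1 - Real.cos x < s} := by
  have hepos := Real.exp_pos (-(p * s))
  have hele : 1 - p * s ≤ Real.exp (-(p * s)) := by
    linarith [Real.add_one_le_exp (-(p * s))]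
  -- The negative values of `1 - p * (1 - cos x)` have modulus at most `2 * p - 1`. Above that
  -- threshold only the cap near `x = 0` remains, and it is contained in the right-hand set.
  rcases lt_or_ge (2 * p - 1) (Real.exp (-(p * s))) with hq | hq
  · apply measure_mono
    intro x hx
    rw [Set.mem_ofPred_eq, lt_abs] at hx
    rw [Set.mem_ofPred_eq]
    have := Real.neg_one_le_cos x
    rcases hx with hx | hx
    · have h1 : p * (1 - Real.cos x) < p * s := by linarith
      exact lt_of_mul_lt_mul_left h1 hp0.le
    · nlinarith
  rcases le_total 2 s with hs2 | hs2
  · refine (measure_mono (Set.subset_univ _)).trans ?_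
    have h1 := ofReal_cosMass_le hs
    refine le_trans ?_ h1
    have h2 : cosMass s = π := by
      rw [cosMass_eq, Real.arccos_of_le_neg_one (by linarith), Real.sin_pi, add_zero]
    have h3 := cosMeasure_Ioc le_rfl Real.pi_pos.le le_rfl
    rw [Real.sin_pi, Real.sin_zero, add_zero, add_zero, sub_zero] at h3
    rw [h2, ← h3, ← Set.union_compl_self (Set.Ioc 0 π)]
    refine (measure_union_le _ _).trans ?_
    rw [cosMeasure_compl, add_zero]
  have h := cosMass_level_le (by linarith) hp1 hs2 hq
  set d₁ := (1 - Real.exp (-(p * s))) / p with hd₁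
  set d₂ := (1 + Real.exp (-(p * s))) / p with hd₂
  have hd₁0 : 0 ≤ d₁ := by
    apply div_nonneg _ hp0.le
    rw [sub_nonneg, Real.exp_le_one_iff]
    nlinarith
  have hd₁₂ : d₁ ≤ d₂ := by
    rw [hd₁, hd₂]
    gcongr
    linarith
  have hd₂2 : d₂ ≤ 2 := by
    rw [hd₂, div_le_iff₀ hp0]
    linarith
  refine le_trans ?_ (ofReal_cosMass_le hs)
  have hsub : {x | Real.exp (-(p * s)) < |1 - p * (1 - Real.cos x)|} ⊆
      Set.Ioc 0 (Real.arccos (1 - d₁)) ∪ Set.Ioc (Real.arccos (1 - d₂)) π ∪ (Set.Ioc 0 π)ᶜ := by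
    intro x hx
    by_cases hxI : x ∈ Set.Ioc 0 π
    · left
      rw [Set.mem_ofPred_eq, lt_abs] at hx
      rcases hx with hx | hx
      · left
        refine ⟨hxI.1, ?_⟩
        rw [← Real.arccos_cos hxI.1.le hxI.2]
        apply Real.arccos_le_arccos
        rw [sub_le_comm, hd₁, le_div_iff₀ hp0]
        linarith
      · right
        refine ⟨?_, hxI.2⟩
        rw [← Real.arccos_cos hxI.1.le hxI.2]
        have h1 : d₂ < 1 - Real.cos x := by
          rw [hd₂, div_lt_iff₀ hp0]
          linarith
        exact Real.strictAntiOn_arccos ⟨Real.neg_one_le_cos x, Real.cos_le_one x⟩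
          ⟨by linarith, by linarith⟩ (by linarith)
    · right
      exact hxI
  refine (measure_mono hsub).trans ((measure_union_le _ _).trans ?_)
  rw [cosMeasure_compl, add_zero]
  refine (measure_union_le _ _).trans ?_
  rw [cosMeasure_Ioc le_rfl (Real.arccos_nonneg _) (Real.arccos_le_pi _),
    cosMeasure_Ioc (Real.arccos_nonneg _) (Real.arccos_le_pi _) le_rfl, ← cosMass_eq, ← cosMass_eq,
    Real.sin_zero, Real.sin_pi, add_zero, add_zero, sub_zero]
  have hm1 : 0 ≤ cosMass d₁ := add_nonneg (Real.arccos_nonneg _) (Real.sqrt_nonneg _)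
  have hm2 : cosMass d₂ ≤ π := by
    rw [← cosMass_two]
    exact monotoneOn_cosMass ⟨hd₁0.trans hd₁₂, hd₂2⟩ ⟨by norm_num, le_rfl⟩ hd₂2
  rw [← ENNReal.ofReal_add hm1 (by linarith)]
  apply ENNReal.ofReal_le_ofReal
  linarith

theorem abs_one_sub_mul_le_one {p : ℝ} (hp0 : 0 ≤ p) (hp1 : p ≤ 1) (x : ℝ) :
    |1 - p * (1 - Real.cos x)| ≤ 1 := by
  have := Real.neg_one_le_cos x
  have := Real.cos_le_one x
  rw [abs_le]
  constructor <;> nlinarith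

/-- Both sides are integrals of level-set measures. At height `exp (-(l * s))`, the exponent `l / p`
turns the left level into `exp (-(p * s))`, so the comparison no longer involves `l`. -/
theorem lintegral_rpow_le_lintegral_exp {p l : ℝ} (hp0 : 0 < p) (hp1 : p ≤ 1) (hl : 0 < l) :
    ∫⁻ x, ENNReal.ofReal (|1 - p * (1 - Real.cos x)| ^ (l / p)) ∂cosMeasure
      ≤ ∫⁻ x, ENNReal.ofReal (Real.exp (-(l * (1 - Real.cos x)))) ∂cosMeasure := by
  have hlp : 0 < l / p := by positivity
  rw [lintegral_eq_lintegral_meas_lt _ (ae_of_all _ fun x => by positivity)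
      (by fun_prop),
    lintegral_eq_lintegral_meas_lt _ (ae_of_all _ fun x => by positivity)
      (by fun_prop)]
  apply setLIntegral_mono' measurableSet_Ioi
  intro t ht
  rw [Set.mem_Ioi] at ht
  rcases le_or_gt 1 t with h1 | h1
  · have hempty : {x | t < |1 - p * (1 - Real.cos x)| ^ (l / p)} = ∅ := by
      ext x
      simp only [Set.mem_ofPred_eq, Set.mem_empty_iff_false, iff_false, not_lt]
      exact (Real.rpow_le_one (abs_nonneg _) (abs_one_sub_mul_le_one hp0.le hp1 x) hlp.le).trans h1
    rw [hempty, measure_empty]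
    exact zero_le
  · obtain ⟨s, hs, rfl⟩ : ∃ s, 0 < s ∧ Real.exp (-(l * s)) = t := by
      refine ⟨-Real.log t / l, div_pos (neg_pos.2 (Real.log_neg ht h1)) hl, ?_⟩
      rw [mul_div_cancel₀ _ hl.ne', neg_neg, Real.exp_log ht]
    have hL : {x | Real.exp (-(l * s)) < |1 - p * (1 - Real.cos x)| ^ (l / p)}
        ⊆ {x | Real.exp (-(p * s)) < |1 - p * (1 - Real.cos x)|} := by
      intro x hx
      by_contra hcon
      rw [Set.mem_ofPred_eq, not_lt] at hcon
      apply absurd hx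
      rw [Set.mem_ofPred_eq, not_lt]
      calc |1 - p * (1 - Real.cos x)| ^ (l / p) ≤ Real.exp (-(p * s)) ^ (l / p) := by gcongr
        _ = Real.exp (-(l * s)) := by
          rw [← Real.exp_mul]
          congr 1
          field_simp
    refine (measure_mono hL).trans ((cosMeasure_level_le hp0 hp1 hs).trans (measure_mono ?_))
    intro x hx
    rw [Set.mem_ofPred_eq] at hx ⊢
    apply Real.exp_lt_exp.2
    nlinarith

/-- **Kanter's inequality**: among sums of symmetrized Bernoulli variables of given total
success probability, the Poisson case dominates. -/
theorem integral_prod_le_besselIntegral {ι : Type*} [Fintype ι] (p : ι → ℝ)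
    (hp0 : ∀ j, 0 ≤ p j) (hp1 : ∀ j, p j ≤ 1) :
    ∫ x in (0 : ℝ)..π, (∏ j, (1 - p j * (1 - Real.cos x))) * (1 + Real.cos x)
      ≤ besselIntegral (∑ j, p j) := by
  rcases (Finset.sum_nonneg fun j _ => hp0 j).eq_or_lt with h0 | hl
  · have hz : ∀ j, p j = 0 := fun j =>
      (Finset.sum_eq_zero_iff_of_nonneg fun j _ => hp0 j).1 h0.symm j (Finset.mem_univ j)
    simp [hz, besselIntegral]
  set l := ∑ j, p j with hl_def
  -- Factors with `p j > 1/2` can be negative, and Hölder needs nonnegative ones.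
  have habs : ∫ x in (0 : ℝ)..π, (∏ j, (1 - p j * (1 - Real.cos x))) * (1 + Real.cos x)
      ≤ ∫ x in (0 : ℝ)..π, (∏ j, |1 - p j * (1 - Real.cos x)|) * (1 + Real.cos x) := by
    apply intervalIntegral.integral_mono_on Real.pi_pos.le
      (Continuous.intervalIntegrable (by fun_prop) _ _)
      (Continuous.intervalIntegrable (by fun_prop) _ _)
    intro x _
    apply mul_le_mul_of_nonneg_right _ (by linarith [Real.neg_one_le_cos x])
    rw [← Finset.abs_prod]
    exact le_abs_self _
  refine habs.trans ?_
  rw [← ENNReal.ofReal_le_ofReal_iff (besselIntegral_nonneg l),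
    ← lintegral_cosMeasure (by fun_prop) (fun x => by positivity)]
  have hB : ENNReal.ofReal (besselIntegral l)
      = ∫⁻ x, ENNReal.ofReal (Real.exp (-(l * (1 - Real.cos x)))) ∂cosMeasure := by
    rw [lintegral_cosMeasure (by fun_prop) (fun x => by positivity), besselIntegral]
  have hsum : ∑ j, p j / l = 1 := by
    rw [← Finset.sum_div, ← hl_def, div_self hl.ne']
  have hfac (x : ℝ) : ENNReal.ofReal (∏ j, |1 - p j * (1 - Real.cos x)|)
      = ∏ j, ENNReal.ofReal (|1 - p j * (1 - Real.cos x)| ^ (l / p j)) ^ (p j / l) := by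
    rw [ENNReal.ofReal_prod_of_nonneg fun j _ => abs_nonneg _]
    apply Finset.prod_congr rfl
    intro j _
    rw [ENNReal.ofReal_rpow_of_nonneg (by positivity) (div_nonneg (hp0 j) hl.le),
      ← Real.rpow_mul (abs_nonneg _)]
    rcases (hp0 j).eq_or_lt with h | h
    -- For `p j = 0` the junk value `l / 0 = 0` is harmless: the factor is `1` and its Hölder weight
    -- is `0`.
    · simp [← h]
    · rw [div_mul_div_cancel₀ h.ne', div_self hl.ne', Real.rpow_one]
  simp_rw [hfac]
  refine (ENNReal.lintegral_prod_norm_pow_le Finset.univ (fun j _ => by fun_prop) hsum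
    (fun j _ => div_nonneg (hp0 j) hl.le)).trans ?_
  calc ∏ j, (∫⁻ x, ENNReal.ofReal (|1 - p j * (1 - Real.cos x)| ^ (l / p j)) ∂cosMeasure)
        ^ (p j / l)
      ≤ ∏ j, ENNReal.ofReal (besselIntegral l) ^ (p j / l) := by
        apply Finset.prod_le_prod'
        intro j _
        rcases (hp0 j).eq_or_lt with h | h
        · simp [← h]
        · rw [hB]
          exact ENNReal.rpow_le_rpow (lintegral_rpow_le_lintegral_exp h (hp1 j) hl)
            (div_nonneg (hp0 j) hl.le)
    _ = ENNReal.ofReal (besselIntegral l) := by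
        have hr (j : ι) : 0 ≤ p j / l := div_nonneg (hp0 j) hl.le
        simp_rw [ENNReal.ofReal_rpow_of_nonneg (besselIntegral_nonneg l) (hr _)]
        rw [← ENNReal.ofReal_prod_of_nonneg
            fun j _ => Real.rpow_nonneg (besselIntegral_nonneg l) _,
          ← Real.rpow_sum_of_nonneg (besselIntegral_nonneg l) fun j _ => hr j, hsum,
          Real.rpow_one]

end Kanter

end Concentration

namespace Concentration

open scoped Real Topology

/-! ### Sperner's theorem and two-valued sums -/

section LittlewoodOfford

/-- **Erdős' Littlewood–Offord bound** for sums of two-valued choices `a j` or `b j`. -/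
theorem card_choices_le {ι : Type*} [Fintype ι] [DecidableEq ι] (a b : ι → ℝ) {t : ℝ}
    (ht : 0 ≤ t) (x : ℝ) :
    ((Finset.univ.filter fun T : Finset ι =>
      ∑ j, (if j ∈ T then b j else a j) ∈ Set.Icc x (x + t)).card : ℝ)
      ≤ 2 ^ Fintype.card ι * centralProb (Finset.univ.filter fun j => t < |b j - a j|).card := by
  classical
  set J := Finset.univ.filter fun j => t < |b j - a j| with hJ
  set 𝒜 := Finset.univ.filter fun T : Finset ι =>
      ∑ j, (if j ∈ T then b j else a j) ∈ Set.Icc x (x + t) with h𝒜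
  -- Fix the choices outside `J`. The admissible choices inside `J` then form an antichain, so
  -- Sperner's bound applies fibrewise.
  have hfib : ∀ R ∈ Jᶜ.powerset, (𝒜.filter fun T => T \ J = R).card
      ≤ J.card.choose (J.card / 2) := by
    intro R _
    -- `φ T` collects the coordinates of `J` at which the larger value is taken. Enlarging it raises
    -- the sum by more than `t`, out of any closed interval of length `t`.
    let φ : Finset ι → Finset J := fun T =>
      Finset.univ.filter fun j : J => ((j : ι) ∈ T ↔ a j < b j)
    have hmemJ {j : ι} (hj : j ∈ J) : t < |b j - a j| := (Finset.mem_filter.1 hj).2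
    have hanti : IsAntichain (· ⊆ ·)
        (SetLike.coe ((𝒜.filter fun T => T \ J = R).image φ)) := by
      intro S hS S' hS' hne hsub
      simp only [SetLike.mem_coe, Finset.mem_image, Finset.mem_filter] at hS hS'
      obtain ⟨T, ⟨hT, hTR⟩, rfl⟩ := hS
      obtain ⟨T', ⟨hT', hTR'⟩, rfl⟩ := hS'
      rw [h𝒜, Finset.mem_filter] at hT hT'
      have hout {j : ι} (hj : j ∉ J) : (j ∈ T ↔ j ∈ T') := by
        have h1 : j ∈ T \ J ↔ j ∈ T' \ J := by rw [hTR, hTR']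
        simpa [hj] using h1
      have hin {j : ι} (hj : j ∈ J) (h : j ∈ T ↔ a j < b j) : (j ∈ T' ↔ a j < b j) := by
        have h1 : (⟨j, hj⟩ : J) ∈ φ T := Finset.mem_filter.2 ⟨Finset.mem_univ _, h⟩
        exact (Finset.mem_filter.1 (hsub h1)).2
      have hchange {j : ι} (hj : j ∈ J) (h : ¬(j ∈ T ↔ a j < b j)) (h' : j ∈ T' ↔ a j < b j) :
          (if j ∈ T' then b j else a j) - (if j ∈ T then b j else a j) = |b j - a j| := by
        have h0 := ht.trans_lt (hmemJ hj)
        by_cases hab : a j < b j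
        · have h1 : j ∈ T' := h'.2 hab
          have h2 : j ∉ T := fun h2 => h ⟨fun _ => hab, fun _ => h2⟩
          rw [if_pos h1, if_neg h2, abs_of_pos (sub_pos.2 hab)]
        · have h1 : j ∉ T' := fun h1 => hab (h'.1 h1)
          have h2 : j ∈ T := by
            by_contra h2
            exact h ⟨fun h3 => absurd h3 h2, fun h3 => absurd h3 hab⟩
          rw [if_neg h1, if_pos h2, abs_of_nonpos (sub_nonpos.2 (not_lt.1 hab)), neg_sub]
      have hdiff (j : ι) :
          0 ≤ (if j ∈ T' then b j else a j) - (if j ∈ T then b j else a j) := by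
        by_cases hj : j ∈ J
        · by_cases h : j ∈ T ↔ a j < b j
          · have h2 : (j ∈ T' ↔ j ∈ T) := (hin hj h).trans h.symm
            simp only [h2, sub_self, le_refl]
          · by_cases h' : j ∈ T' ↔ a j < b j
            · rw [hchange hj h h']
              exact abs_nonneg _
            · have h2 : (j ∈ T' ↔ j ∈ T) := by tauto
              simp only [h2, sub_self, le_refl]
        · simp only [hout hj, sub_self, le_refl]
      obtain ⟨⟨i, hi⟩, hi', hi''⟩ : ∃ j ∈ φ T', j ∉ φ T := by
        by_contra! hcon
        exact hne (Finset.Subset.antisymm hsub hcon)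
      have hd : |b i - a i| ≤ ∑ j, ((if j ∈ T' then b j else a j)
          - (if j ∈ T then b j else a j)) := by
        have h1 := (Finset.mem_filter.1 hi').2
        have h2 : ¬(i ∈ T ↔ a i < b i) := fun h =>
          hi'' (Finset.mem_filter.2 ⟨Finset.mem_univ _, h⟩)
        rw [← hchange hi h2 h1]
        exact Finset.single_le_sum (f := fun j => (if j ∈ T' then b j else a j)
          - (if j ∈ T then b j else a j)) (fun j _ => hdiff j) (Finset.mem_univ i)
      rw [Finset.sum_sub_distrib] at hd
      have := hmemJ hi
      have := hT.2.1
      have := hT'.2.2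
      linarith
    have hinj : Set.InjOn φ ((𝒜.filter fun T => T \ J = R : Finset (Finset ι)) :
        Set (Finset ι)) := by
      intro T hT T' hT' h
      have hTR := (Finset.mem_filter.1 (Finset.mem_coe.1 hT)).2
      have hTR' := (Finset.mem_filter.1 (Finset.mem_coe.1 hT')).2
      ext j
      by_cases hj : j ∈ J
      · have h1 : (⟨j, hj⟩ : J) ∈ φ T ↔ (⟨j, hj⟩ : J) ∈ φ T' := by rw [h]
        simp only [φ, Finset.mem_filter, Finset.mem_univ, true_and] at h1
        tauto
      · have h1 : j ∈ T \ J ↔ j ∈ T' \ J := by rw [hTR, hTR']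
        simpa [hj] using h1
    rw [← Finset.card_image_of_injOn hinj]
    simpa using hanti.sperner
  have hcard := Finset.card_le_mul_card_image_of_maps_to (s := 𝒜) (t := Jᶜ.powerset)
    (f := fun T => T \ J) (fun T _ => Finset.mem_powerset.2 fun j hj => by
      rw [Finset.mem_compl]
      exact (Finset.mem_sdiff.1 hj).2) _ hfib
  rw [Finset.card_powerset, Finset.card_compl] at hcard
  have hle : J.card ≤ Fintype.card ι := Finset.card_le_univ J
  calc (𝒜.card : ℝ) ≤ (J.card.choose (J.card / 2) * 2 ^ (Fintype.card ι - J.card) : ℕ) := by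
        exact_mod_cast hcard
    _ = 2 ^ Fintype.card ι * centralProb J.card := by
        rw [centralProb]
        push_cast
        rw [pow_sub₀ _ two_ne_zero hle]
        field_simp

end LittlewoodOfford

/-! ### Quantile coupling and the spread probability -/

section Quantile

variable {Ω : Type*} [MeasurableSpace Ω] (P : Measure Ω) [IsProbabilityMeasure P] {X : Ω → ℝ}

theorem quantile_le_iff (hX : Measurable X) {y : ℝ} (hy : y ∈ Set.Ioo (0 : ℝ) 1) (x : ℝ) :
    quantile P X y ≤ x ↔ y ≤ P.real {ω | X ω ≤ x} := by
  have : IsProbabilityMeasure (P.map X) := Measure.isProbabilityMeasure_map hX.aemeasurable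
  have hF (x : ℝ) : P.real {ω | X ω ≤ x} = cdf (P.map X) x := by
    rw [cdf_eq_real, map_measureReal_apply hX measurableSet_Iic]
    rfl
  simp only [quantile, hF]
  have hbdd : BddBelow {x : ℝ | y ≤ cdf (P.map X) x} := by
    obtain ⟨z, hz⟩ := ((tendsto_cdf_atBot (P.map X)).eventually_lt_const hy.1).exists
    refine ⟨z, fun w hw => ?_⟩
    by_contra! hlt
    exact absurd (monotone_cdf _ hlt.le) (not_le.2 (hz.trans_le hw))
  have hne : {x : ℝ | y ≤ cdf (P.map X) x}.Nonempty := by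
    obtain ⟨z, hz⟩ := ((tendsto_cdf_atTop (P.map X)).eventually_const_lt hy.2).exists
    exact ⟨z, hz.le⟩
  constructor
  · intro h
    have hright : Tendsto (cdf (P.map X)) (𝓝[>] x) (𝓝 (cdf (P.map X) x)) :=
      ((cdf (P.map X)).right_continuous x).mono_left (nhdsWithin_mono _ Set.Ioi_subset_Ici_self)
    apply ge_of_tendsto hright
    filter_upwards [self_mem_nhdsWithin] with z hz
    obtain ⟨w, hw, hwz⟩ := exists_lt_of_csInf_lt hne (h.trans_lt hz)
    exact le_trans hw (monotone_cdf _ hwz.le)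
  · intro h
    exact csInf_le hbdd h

theorem monotoneOn_quantile (hX : Measurable X) :
    MonotoneOn (quantile P X) (Set.Ioo 0 1) := by
  intro y hy z hz hyz
  rw [quantile_le_iff P hX hy]
  exact hyz.trans ((quantile_le_iff P hX hz _).1 le_rfl)

/-- The quantile function restricted to `(0, 1)` and extended by zero. -/
noncomputable def quantileExt (P : Measure Ω) (X : Ω → ℝ) : ℝ → ℝ :=
  (Set.Ioo 0 1).indicator (quantile P X)

theorem measurable_quantileExt (hX : Measurable X) : Measurable (quantileExt P X) := by
  apply measurable_of_Iic
  intro x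
  have h : quantileExt P X ⁻¹' Set.Iic x
      = (Set.Ioo 0 1 ∩ Set.Iic (P.real {ω | X ω ≤ x})) ∪ ((Set.Ioo 0 1)ᶜ ∩ {_y | 0 ≤ x}) := by
    ext y
    by_cases hy : y ∈ Set.Ioo (0 : ℝ) 1
    · have h1 : quantileExt P X y = quantile P X y := Set.indicator_of_mem hy _
      rw [Set.mem_preimage, Set.mem_Iic, h1, quantile_le_iff P hX hy]
      simp only [Set.mem_union, Set.mem_inter_iff, hy, true_and, Set.mem_compl_iff,
        not_true_eq_false, false_and, or_false, Set.mem_Iic]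
    · have h1 : quantileExt P X y = 0 := Set.indicator_of_notMem hy _
      rw [Set.mem_preimage, Set.mem_Iic, h1]
      simp only [Set.mem_union, Set.mem_inter_iff, hy, false_and, Set.mem_compl_iff,
        not_false_eq_true, true_and, false_or, Set.mem_ofPred_eq]
  rw [h]
  exact (measurableSet_Ioo.inter measurableSet_Iic).union
    (measurableSet_Ioo.compl.inter (MeasurableSet.const _))

/-- The uniform distribution on `(0, 1)`. -/
noncomputable def uniform : Measure ℝ := volume.restrict (Set.Ioo 0 1)

instance : IsProbabilityMeasure uniform := ⟨by simp [uniform]⟩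

theorem map_quantileExt (hX : Measurable X) : uniform.map (quantileExt P X) = P.map X := by
  have : IsProbabilityMeasure (P.map X) := Measure.isProbabilityMeasure_map hX.aemeasurable
  symm
  apply Measure.ext_of_Iic
  intro x
  have h0 : 0 ≤ P.real {ω | X ω ≤ x} := measureReal_nonneg
  have h1 : P.real {ω | X ω ≤ x} ≤ 1 := measureReal_le_one
  rw [Measure.map_apply hX measurableSet_Iic,
    Measure.map_apply (measurable_quantileExt P hX) measurableSet_Iic, uniform,
    Measure.restrict_apply (measurable_quantileExt P hX measurableSet_Iic)]
  have hset : quantileExt P X ⁻¹' Set.Iic x ∩ Set.Ioo 0 1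
      = Set.Iic (P.real {ω | X ω ≤ x}) ∩ Set.Ioo 0 1 := by
    ext y
    simp only [Set.mem_inter_iff, and_congr_left_iff, Set.mem_preimage, Set.mem_Iic]
    intro hy
    rw [quantileExt, Set.indicator_of_mem hy, quantile_le_iff P hX hy]
  have hPx : P (X ⁻¹' Set.Iic x) = ENNReal.ofReal (P.real {ω | X ω ≤ x}) := by
    rw [ofReal_measureReal]
    rfl
  rw [hset, hPx]
  apply le_antisymm
  · calc ENNReal.ofReal (P.real {ω | X ω ≤ x})
        = volume (Set.Ioo 0 (P.real {ω | X ω ≤ x})) := by rw [Real.volume_Ioo, sub_zero]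
      _ ≤ volume (Set.Iic (P.real {ω | X ω ≤ x}) ∩ Set.Ioo 0 1) :=
          measure_mono fun y hy => ⟨hy.2.le, hy.1, hy.2.trans_le h1⟩
  · calc volume (Set.Iic (P.real {ω | X ω ≤ x}) ∩ Set.Ioo 0 1)
        ≤ volume (Set.Ioc 0 (P.real {ω | X ω ≤ x})) :=
          measure_mono fun y hy => ⟨hy.2.1, hy.1⟩
      _ = ENNReal.ofReal (P.real {ω | X ω ≤ x}) := by rw [Real.volume_Ioc, sub_zero]

theorem measurePreserving_one_sub : MeasurePreserving (fun y : ℝ => 1 - y) uniform uniform := by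
  have h := (Measure.measurePreserving_sub_left volume (1 : ℝ)).restrict_preimage
    (s := Set.Ioo 0 1) measurableSet_Ioo
  have hs : (fun y : ℝ => 1 - y) ⁻¹' Set.Ioo 0 1 = Set.Ioo 0 1 := by
    ext y
    simp only [Set.mem_preimage, Set.mem_Ioo]
    constructor <;> rintro ⟨h1, h2⟩ <;> constructor <;> linarith
  rw [hs] at h
  exact h

theorem bddAbove_conc (X : Ω → ℝ) (t : ℝ) :
    BddAbove (Set.range fun x : ℝ => P.real {ω | X ω ∈ Set.Icc x (x + t)}) :=
  ⟨1, by rintro _ ⟨x, rfl⟩; exact measureReal_le_one⟩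

theorem le_conc (X : Ω → ℝ) (t x : ℝ) :
    P.real {ω | X ω ∈ Set.Icc x (x + t)} ≤ conc P X t :=
  le_ciSup (bddAbove_conc P X t) x

theorem conc_nonneg (X : Ω → ℝ) (t : ℝ) : 0 ≤ conc P X t :=
  measureReal_nonneg.trans (le_conc P X t 0)

theorem conc_le_one (X : Ω → ℝ) (t : ℝ) : conc P X t ≤ 1 :=
  ciSup_le fun _ => measureReal_le_one

/-- The set of levels `y` for which the quantiles of orders `y` and `1 - y` are more than `t`
apart. -/
def spreadSet (P : Measure Ω) (X : Ω → ℝ) (t : ℝ) : Set ℝ :=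
  {y | t < |quantileExt P X (1 - y) - quantileExt P X y|}

theorem measurableSet_spreadSet (hX : Measurable X) (t : ℝ) :
    MeasurableSet (spreadSet P X t) := by
  have h := measurable_quantileExt P hX
  have h2 : Measurable fun y => quantileExt P X (1 - y) := h.comp (measurable_const.sub measurable_id)
  have h3 : Measurable fun y => |quantileExt P X (1 - y) - quantileExt P X y| :=
    (h2.sub h).norm
  exact measurableSet_lt measurable_const h3

theorem intervalIntegrable_indicator_one {s : Set ℝ} (hs : MeasurableSet s) (a b : ℝ) :
    IntervalIntegrable (s.indicator fun _ => (1 : ℝ)) volume a b := by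
  have h : IntervalIntegrable (fun _ => (1 : ℝ)) volume a b := intervalIntegrable_const
  exact ⟨h.1.indicator hs, h.2.indicator hs⟩

theorem spreadProb_eq_integral_half (hX : Measurable X) (t : ℝ) :
    spreadProb P X t
      = 2 * ∫ y in (0 : ℝ)..(1 / 2), (spreadSet P X t).indicator (fun _ => 1) y := by
  rw [spreadProb]
  congr 1
  apply intervalIntegral.integral_congr_ae
  apply ae_of_all
  intro y hy
  rw [Set.uIoc_of_le (by norm_num)] at hy
  have hy1 : y ∈ Set.Ioo (0 : ℝ) 1 := ⟨hy.1, by linarith [hy.2]⟩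
  have hy2 : 1 - y ∈ Set.Ioo (0 : ℝ) 1 := ⟨by linarith [hy.2], by linarith [hy.1]⟩
  have hle := monotoneOn_quantile P hX hy1 hy2 (by linarith [hy.2])
  simp only [Set.indicator, spreadSet, quantileExt, hy1, hy2, if_true, Set.mem_Ioi,
    Set.mem_ofPred_eq, abs_of_nonneg (sub_nonneg.2 hle)]

/-- The spread set is invariant under `y ↦ 1 - y`, so twice its mass on the left half is its full
uniform measure. This makes `spreadProb` the mean of an indicator. -/
theorem spreadProb_eq (hX : Measurable X) (t : ℝ) :
    spreadProb P X t = uniform.real (spreadSet P X t) := by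
  have hS := measurableSet_spreadSet P hX t
  have h1 : uniform.real (spreadSet P X t)
      = ∫ y in (0 : ℝ)..1, (spreadSet P X t).indicator (fun _ => 1) y := by
    rw [intervalIntegral.integral_of_le zero_le_one, integral_Ioc_eq_integral_Ioo]
    exact (integral_indicator_one (μ := uniform) hS).symm
  have h2 : ∫ y in (1 / 2 : ℝ)..1, (spreadSet P X t).indicator (fun _ => (1 : ℝ)) y
      = ∫ y in (0 : ℝ)..(1 / 2), (spreadSet P X t).indicator (fun _ => (1 : ℝ)) y := by
    have h := intervalIntegral.integral_comp_sub_left (a := 0) (b := 1 / 2)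
      (fun y => (spreadSet P X t).indicator (fun _ => (1 : ℝ)) y) 1
    rw [show (1 : ℝ) - 1 / 2 = 1 / 2 by norm_num, sub_zero] at h
    rw [← h]
    congr 1
    ext y
    have hmem : 1 - y ∈ spreadSet P X t ↔ y ∈ spreadSet P X t := by
      rw [spreadSet, Set.mem_ofPred_eq, Set.mem_ofPred_eq, sub_sub_cancel, abs_sub_comm]
    by_cases hy : y ∈ spreadSet P X t
    · rw [Set.indicator_of_mem hy, Set.indicator_of_mem (hmem.2 hy)]
    · rw [Set.indicator_of_notMem hy, Set.indicator_of_notMem (mt hmem.1 hy)]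
  rw [h1, ← intervalIntegral.integral_add_adjacent_intervals (b := 1 / 2)
    (intervalIntegrable_indicator_one hS _ _) (intervalIntegrable_indicator_one hS _ _), h2,
    spreadProb_eq_integral_half P hX]
  ring

theorem spreadProb_nonneg (hX : Measurable X) (t : ℝ) : 0 ≤ spreadProb P X t := by
  rw [spreadProb_eq P hX]
  exact measureReal_nonneg

theorem one_sub_conc_le_spreadProb (hX : Measurable X) (t : ℝ) :
    1 - conc P X t ≤ spreadProb P X t := by
  have hc0 := conc_nonneg P X t
  have hc1 := conc_le_one P X t
  have hS := measurableSet_spreadSet P hX t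
  -- If the quantiles at `y` and `1 - y` are within `t`, then an interval of length `t` carries mass
  -- at least `1 - 2 * y`, which exceeds `conc P X t` for these `y`.
  have hsub : Set.Ioo 0 ((1 - conc P X t) / 2) ⊆ spreadSet P X t := by
    intro y hy
    by_contra hcon
    have hy1 : y ∈ Set.Ioo (0 : ℝ) 1 := ⟨hy.1, by linarith [hy.2]⟩
    have hy2 : 1 - y ∈ Set.Ioo (0 : ℝ) 1 := ⟨by linarith [hy1.2], by linarith [hy.1]⟩
    have hmono := monotoneOn_quantile P hX
    have hle := hmono hy1 hy2 (by linarith [hy.2])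
    rw [spreadSet, Set.mem_ofPred_eq, not_lt, quantileExt, Set.indicator_of_mem hy1,
      Set.indicator_of_mem hy2, abs_of_nonneg (sub_nonneg.2 hle)] at hcon
    have hI := le_conc P X t (quantile P X y)
    have hP : P.real {ω | X ω ∈ Set.Icc (quantile P X y) (quantile P X y + t)}
        = uniform.real (quantileExt P X ⁻¹' Set.Icc (quantile P X y) (quantile P X y + t)) := by
      rw [← map_measureReal_apply (measurable_quantileExt P hX) measurableSet_Icc,
        map_quantileExt P hX, map_measureReal_apply hX measurableSet_Icc]
      rfl
    have hU : 1 - 2 * y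
        ≤ uniform.real (quantileExt P X ⁻¹' Set.Icc (quantile P X y) (quantile P X y + t)) := by
      have h1 : Set.Icc y (1 - y)
          ⊆ quantileExt P X ⁻¹' Set.Icc (quantile P X y) (quantile P X y + t) := by
        intro z hz
        have hz1 : z ∈ Set.Ioo (0 : ℝ) 1 := ⟨by linarith [hz.1, hy.1], by linarith [hz.2, hy.1]⟩
        rw [Set.mem_preimage, quantileExt, Set.indicator_of_mem hz1]
        exact ⟨hmono hy1 hz1 hz.1, (hmono hz1 hy2 hz.2).trans (by linarith)⟩
      have h2 : uniform.real (Set.Icc y (1 - y)) = 1 - 2 * y := by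
        rw [uniform, measureReal_restrict_apply measurableSet_Icc, Set.inter_eq_left.2]
        · rw [Real.volume_real_Icc_of_le (by linarith [hy.2])]
          ring
        · exact fun z hz => ⟨by linarith [hz.1, hy.1], by linarith [hz.2, hy.1]⟩
      rw [← h2]
      exact measureReal_mono h1
    linarith [hy.2]
  rw [spreadProb_eq_integral_half P hX]
  have h1 : (1 - conc P X t) / 2
      = ∫ y in (0 : ℝ)..(1 / 2), (Set.Ioo 0 ((1 - conc P X t) / 2)).indicator (fun _ => (1 : ℝ)) y := by
    rw [intervalIntegral.integral_of_le (by norm_num), setIntegral_indicator measurableSet_Ioo,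
      Set.inter_eq_right.2]
    · rw [setIntegral_const, smul_eq_mul, mul_one, Real.volume_real_Ioo_of_le (by linarith), sub_zero]
    · exact fun z hz => ⟨hz.1, by linarith [hz.2]⟩
  have h2 : ∫ y in (0 : ℝ)..(1 / 2),
        (Set.Ioo 0 ((1 - conc P X t) / 2)).indicator (fun _ => (1 : ℝ)) y
      ≤ ∫ y in (0 : ℝ)..(1 / 2), (spreadSet P X t).indicator (fun _ => 1) y :=
    intervalIntegral.integral_mono_on (by norm_num)
      (intervalIntegrable_indicator_one measurableSet_Ioo _ _)
      (intervalIntegrable_indicator_one hS _ _)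
      fun y _ => Set.indicator_le_indicator_of_subset hsub (fun _ => zero_le_one) y
  linarith

end Quantile
end Concentration

namespace Concentration

open scoped Real Topology

/-! ### Random reflections and the main bound -/

section SumBound

variable {Ω : Type*} [MeasurableSpace Ω] (P : Measure Ω) [IsProbabilityMeasure P]
  {ι : Type*} [Fintype ι] {X : ι → Ω → ℝ}

theorem measureReal_sum_eq (hX : ∀ j, Measurable (X j)) (hind : iIndepFun X P)
    {s : Set ℝ} (hs : MeasurableSet s) :
    P.real {ω | ∑ j, X j ω ∈ s}
      = (Measure.pi fun _ : ι => uniform).real {u | ∑ j, quantileExt P (X j) (u j) ∈ s} := by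
  have hq (j : ι) := measurable_quantileExt P (hX j)
  have : ∀ j, IsProbabilityMeasure (uniform.map (quantileExt P (X j))) := fun j =>
    Measure.isProbabilityMeasure_map (hq j).aemeasurable
  have hmeas : MeasurableSet {v : ι → ℝ | ∑ j, v j ∈ s} :=
    (Finset.measurable_sum _ fun j _ => measurable_pi_apply j) hs
  have h1 : P.map (fun ω j => X j ω)
      = (Measure.pi fun _ : ι => uniform).map fun u j => quantileExt P (X j) (u j) := by
    rw [Measure.pi_map_pi fun j => (hq j).aemeasurable,
      hind.map_fun_eq_pi_map fun j => (hX j).aemeasurable]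
    simp_rw [map_quantileExt P (hX _)]
  have h2 := map_measureReal_apply (μ := P) (measurable_pi_lambda _ hX) hmeas
  have h3 := map_measureReal_apply (μ := Measure.pi fun _ : ι => uniform)
    (f := fun u j => quantileExt P (X j) (u j))
    (measurable_pi_lambda _ fun j => (hq j).comp (measurable_pi_apply j)) hmeas
  rw [h1, h3] at h2
  exact h2.symm

open Classical in
/-- Reflection `y ↦ 1 - y` of the coordinates in `T`. -/
noncomputable def reflect (T : Finset ι) (u : ι → ℝ) : ι → ℝ :=
  fun j => if j ∈ T then 1 - u j else u j

theorem measurePreserving_reflect (T : Finset ι) :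
    MeasurePreserving (reflect T) (Measure.pi fun _ : ι => uniform)
      (Measure.pi fun _ : ι => uniform) := by
  classical
  apply measurePreserving_pi (fun _ : ι => uniform) (fun _ : ι => uniform)
    (f := fun j y => if j ∈ T then 1 - y else y)
  intro j
  by_cases h : j ∈ T
  · simpa only [h, if_true] using measurePreserving_one_sub
  · simp only [h, if_false]
    exact MeasurePreserving.id uniform

/-- All `2 ^ n` reflections preserve the product measure, so the measure of `E` is the mean of the
proportion of reflected points that lie in `E`. This turns a pointwise count into a probability
bound without conditioning. -/
theorem two_pow_mul_measureReal_le {E : Set (ι → ℝ)} (hE : MeasurableSet E) {f : (ι → ℝ) → ℝ}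
    (hf : Integrable f (Measure.pi fun _ : ι => uniform))
    (hcount : ∀ u, ∑ T : Finset ι, E.indicator (fun _ => (1 : ℝ)) (reflect T u) ≤ f u) :
    2 ^ Fintype.card ι * (Measure.pi fun _ : ι => uniform).real E
      ≤ ∫ u, f u ∂(Measure.pi fun _ : ι => uniform) := by
  have hint : Integrable (E.indicator fun _ => (1 : ℝ)) (Measure.pi fun _ : ι => uniform) :=
    (integrable_const 1).indicator hE
  have hT (T : Finset ι) : ∫ u, E.indicator (fun _ => (1 : ℝ)) (reflect T u)
        ∂(Measure.pi fun _ : ι => uniform)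
      = (Measure.pi fun _ : ι => uniform).real E := by
    have h := measurePreserving_reflect T
    rw [← integral_map h.measurable.aemeasurable (by rw [h.map_eq]; exact hint.1), h.map_eq]
    exact integral_indicator_one hE
  have hTint (T : Finset ι) : Integrable (fun u => E.indicator (fun _ => (1 : ℝ)) (reflect T u))
      (Measure.pi fun _ : ι => uniform) :=
    (measurePreserving_reflect T).integrable_comp_of_integrable hint
  calc 2 ^ Fintype.card ι * (Measure.pi fun _ : ι => uniform).real E
      = ∑ T : Finset ι, ∫ u, E.indicator (fun _ => (1 : ℝ)) (reflect T u)
        ∂(Measure.pi fun _ : ι => uniform) := by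
        simp [hT, Finset.sum_const, Finset.card_univ]
    _ = ∫ u, ∑ T : Finset ι, E.indicator (fun _ => (1 : ℝ)) (reflect T u)
        ∂(Measure.pi fun _ : ι => uniform) := (integral_finsetSum _ fun T _ => hTint T).symm
    _ ≤ _ := integral_mono (integrable_finsetSum _ fun T _ => hTint T) hf hcount

open Classical in
-- Write `centralProb` as a cosine integral and exchange the integrals. The power of `cos x` is a
-- product over independent coordinates, each of mean `1 - uniform.real (A j) * (1 - cos x)`.
theorem integral_centralProb_card {A : ι → Set ℝ} (hA : ∀ j, MeasurableSet (A j)) :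
    Integrable (fun u : ι → ℝ => centralProb (Finset.univ.filter fun j => u j ∈ A j).card)
      (Measure.pi fun _ : ι => uniform) ∧
    ∫ u : ι → ℝ, π * centralProb (Finset.univ.filter fun j => u j ∈ A j).card
        ∂(Measure.pi fun _ : ι => uniform)
      = ∫ x in (0 : ℝ)..π, (∏ j, (1 - uniform.real (A j) * (1 - Real.cos x)))
        * (1 + Real.cos x) := by
  have hpow (u : ι → ℝ) (x : ℝ) :
      Real.cos x ^ (Finset.univ.filter fun j => u j ∈ A j).card
        = ∏ j, if u j ∈ A j then Real.cos x else 1 := by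
    rw [Finset.prod_ite]
    simp
  have hb (u : ι → ℝ) (x : ℝ) :
      ‖(∏ j, if u j ∈ A j then Real.cos x else 1) * (1 + Real.cos x)‖ ≤ 2 := by
    rw [← hpow, norm_mul, norm_pow, Real.norm_eq_abs, Real.norm_eq_abs]
    have h1 := Real.abs_cos_le_one x
    have h2 : |1 + Real.cos x| ≤ 2 := by
      have := Real.neg_one_le_cos x
      have := Real.cos_le_one x
      rw [abs_le]
      constructor <;> linarith
    have h3 : |Real.cos x| ^ (Finset.univ.filter fun j => u j ∈ A j).card ≤ 1 :=
      pow_le_one₀ (abs_nonneg _) h1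
    nlinarith [abs_nonneg (1 + Real.cos x)]
  have hm : Measurable (Function.uncurry fun (x : ℝ) (u : ι → ℝ) =>
      (∏ j, if u j ∈ A j then Real.cos x else 1) * (1 + Real.cos x)) := by
    apply Measurable.mul
    · apply Finset.measurable_prod
      intro j _
      apply Measurable.ite
      · exact ((measurable_pi_apply j).comp measurable_snd) (hA j)
      · fun_prop
      · fun_prop
    · fun_prop
  have hfin : IsFiniteMeasure (volume.restrict (Set.uIoc (0 : ℝ) π)) :=
    isFiniteMeasure_restrict.2 (by simp [Set.uIoc])
  have hint : Integrable (Function.uncurry fun (x : ℝ) (u : ι → ℝ) =>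
      (∏ j, if u j ∈ A j then Real.cos x else 1) * (1 + Real.cos x))
      ((volume.restrict (Set.uIoc 0 π)).prod (Measure.pi fun _ : ι => uniform)) :=
    Integrable.of_bound hm.aestronglyMeasurable 2 (ae_of_all _ fun z => hb z.2 z.1)
  have hcp (u : ι → ℝ) : π * centralProb (Finset.univ.filter fun j => u j ∈ A j).card
      = ∫ x in (0 : ℝ)..π, (∏ j, if u j ∈ A j then Real.cos x else 1) * (1 + Real.cos x) := by
    rw [← integral_cos_pow_mul_one_add_cos]
    simp_rw [hpow]
  constructor
  · have h1 := hint.integral_prod_right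
    have h2 : Integrable (fun u : ι → ℝ =>
        π * centralProb (Finset.univ.filter fun j => u j ∈ A j).card)
        (Measure.pi fun _ : ι => uniform) := by
      refine h1.congr (ae_of_all _ fun u => ?_)
      simp only [hcp, Function.uncurry]
      rw [intervalIntegral.integral_of_le Real.pi_pos.le, Set.uIoc_of_le Real.pi_pos.le]
    refine (h2.const_mul π⁻¹).congr (ae_of_all _ fun u => ?_)
    simp only
    rw [inv_mul_cancel_left₀ Real.pi_pos.ne']
  · simp_rw [hcp]
    rw [← intervalIntegral_integral_swap hint]
    congr 1
    ext x
    rw [integral_mul_const]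
    congr 1
    rw [integral_fintype_prod_eq_prod (μ := fun _ : ι => uniform)
      (f := fun j y => if y ∈ A j then Real.cos x else 1)]
    apply Finset.prod_congr rfl
    intro j _
    have h1 : (fun y => if y ∈ A j then Real.cos x else (1 : ℝ))
        = fun y => 1 - (A j).indicator (fun _ => (1 : ℝ)) y * (1 - Real.cos x) := by
      ext y
      by_cases h : y ∈ A j <;> simp [h]
    have h2 : Integrable ((A j).indicator fun _ => (1 : ℝ)) uniform :=
      (integrable_const 1).indicator (hA j)
    have h3 : ∫ y, (A j).indicator (fun _ => (1 : ℝ)) y ∂uniform = uniform.real (A j) :=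
      integral_indicator_one (hA j)
    rw [h1, integral_sub (integrable_const 1) (h2.mul_const _), integral_mul_const, h3]
    simp

/-- **Concentration of sums of independent variables**, bounded by a Bessel function of the
total spread. -/
theorem conc_sum_le_G (hX : ∀ j, Measurable (X j)) (hind : iIndepFun X P) {t : ℝ} (ht : 0 ≤ t) :
    conc P (fun ω => ∑ j, X j ω) t ≤ G (∑ j, spreadProb P (X j) t) := by
  classical
  apply ciSup_le
  intro x
  have hq (j : ι) := measurable_quantileExt P (hX j)
  rw [measureReal_sum_eq P hX hind measurableSet_Icc]
  set E : Set (ι → ℝ) := {u | ∑ j, quantileExt P (X j) (u j) ∈ Set.Icc x (x + t)} with hE_def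
  have hE : MeasurableSet E :=
    (Finset.measurable_sum _ fun j _ => (hq j).comp (measurable_pi_apply j)) measurableSet_Icc
  obtain ⟨hint, hval⟩ := integral_centralProb_card
    (A := fun j => spreadSet P (X j) t) fun j => measurableSet_spreadSet P (hX j) t
  -- For fixed `u`, the reflected points give exactly the sums of choices between the quantiles at
  -- `u j` and `1 - u j`, and the coordinates more than `t` apart are those with `u j` in the spread
  -- set.
  have hmain := two_pow_mul_measureReal_le hE (hint.const_mul (2 ^ Fintype.card ι))
    (fun u => by
      have h := card_choices_le (fun j => quantileExt P (X j) (u j))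
        (fun j => quantileExt P (X j) (1 - u j)) ht x
      refine le_trans (le_of_eq ?_) h
      rw [Finset.card_filter]
      push_cast
      apply Finset.sum_congr rfl
      intro T _
      have hsum : ∑ j, quantileExt P (X j) (reflect T u j)
          = ∑ j, if j ∈ T then quantileExt P (X j) (1 - u j) else quantileExt P (X j) (u j) := by
        apply Finset.sum_congr rfl
        intro j _
        by_cases h : j ∈ T <;> simp [reflect, h]
      simp only [Set.indicator, hE_def, Set.mem_ofPred_eq, hsum])
  rw [integral_const_mul] at hmain
  have h1 := le_of_mul_le_mul_left hmain (by positivity)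
  rw [integral_const_mul] at hval
  have hK := integral_prod_le_besselIntegral (fun j => uniform.real (spreadSet P (X j) t))
    (fun j => measureReal_nonneg) (fun j => measureReal_le_one)
  rw [← hval, ← pi_mul_G] at hK
  simp_rw [spreadProb_eq P (hX _)]
  exact h1.trans (le_of_mul_le_mul_left hK Real.pi_pos)

end SumBound

/-! ### Sums of symmetric signs -/

section Signs

variable {Ω : Type*} [MeasurableSpace Ω] (P : Measure Ω) [IsProbabilityMeasure P]

theorem spreadProb_sign {X : Ω → ℝ} (hX : Measurable X) {a t : ℝ} (hat : t < 2 * a)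
    (h1 : P.real {ω | X ω = a} = 1 / 2) (h2 : P.real {ω | X ω = -a} = 1 / 2) :
    spreadProb P X t = 1 := by
  have hq {y x : ℝ} (hy : y ∈ Set.Ioo (0 : ℝ) 1) := quantile_le_iff P hX hy x
  have hlow {y : ℝ} (hy : y ∈ Set.Ioo (0 : ℝ) (1 / 2)) : quantile P X y ≤ -a := by
    rw [quantile_le_iff P hX ⟨hy.1, by linarith [hy.2]⟩]
    refine hy.2.le.trans (h2.symm.le.trans (measureReal_mono ?_))
    intro ω hω
    exact le_of_eq hω
  have hhigh {y : ℝ} (hy : y ∈ Set.Ioo (1 / 2 : ℝ) 1) : a ≤ quantile P X y := by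
    by_contra! hlt
    have h3 := (quantile_le_iff P hX ⟨by linarith [hy.1], hy.2⟩ _).1 (le_refl (quantile P X y))
    have h4 : P.real {ω | X ω ≤ quantile P X y} + P.real {ω | X ω = a} ≤ 1 := by
      rw [← measureReal_union]
      · exact measureReal_le_one
      · rw [Set.disjoint_left]
        intro ω hω hω'
        exact absurd (hω : X ω ≤ _) (not_le.2 ((hω' : X ω = a) ▸ hlt))
      · exact hX (measurableSet_singleton a)
    linarith [hy.1]
  rw [spreadProb]
  have hint : ∫ y in (0 : ℝ)..(1 / 2),
      (Set.Ioi t).indicator (fun _ => (1 : ℝ)) (quantile P X (1 - y) - quantile P X y)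
      = ∫ y in (0 : ℝ)..(1 / 2), (1 : ℝ) := by
    rw [intervalIntegral.integral_of_le (by norm_num), intervalIntegral.integral_of_le (by norm_num),
      integral_Ioc_eq_integral_Ioo, integral_Ioc_eq_integral_Ioo]
    apply setIntegral_congr_fun measurableSet_Ioo
    intro y hy
    apply Set.indicator_of_mem
    have h3 := hlow hy
    have h4 := hhigh (y := 1 - y) ⟨by linarith [hy.2], by linarith [hy.1]⟩
    rw [Set.mem_Ioi]
    linarith
  rw [hint]
  simp

theorem centralProb_le_conc {ι : Type*} [Fintype ι] {X : ι → Ω → ℝ} (hX : ∀ j, Measurable (X j))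
    (hind : iIndepFun X P) {a t : ℝ} (ha : 0 < a) (ht : 0 ≤ t)
    (h1 : ∀ j, P.real {ω | X j ω = a} = 1 / 2) (h2 : ∀ j, P.real {ω | X j ω = -a} = 1 / 2) :
    centralProb (Fintype.card ι) ≤ conc P (fun ω => ∑ j, X j ω) t := by
  classical
  set n := Fintype.card ι with hn
  let F : Finset ι → Set Ω := fun T =>
    ⋂ j ∈ (Finset.univ : Finset ι), X j ⁻¹' {if j ∈ T then a else -a}
  have hF (T : Finset ι) : P.real (F T) = (1 / 2) ^ n := by
    have h := hind.measure_inter_preimage_eq_mul Finset.univ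
      (sets := fun j => {if j ∈ T then a else -a}) (fun j _ => measurableSet_singleton _)
    rw [measureReal_def, h, ENNReal.toReal_prod]
    have hj (j : ι) : (P (X j ⁻¹' {if j ∈ T then a else -a})).toReal = 1 / 2 := by
      by_cases hjT : j ∈ T
      · simp only [hjT, if_true]
        exact h1 j
      · simp only [hjT, if_false]
        exact h2 j
    simp_rw [hj]
    rw [Finset.prod_const, Finset.card_univ]
  have hmem {T : Finset ι} {ω : Ω} (hω : ω ∈ F T) (j : ι) : X j ω = if j ∈ T then a else -a :=
    Set.mem_iInter₂.1 hω j (Finset.mem_univ j)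
  have hFm (T : Finset ι) : MeasurableSet (F T) :=
    Finset.measurableSet_biInter _ fun j _ => hX j (measurableSet_singleton _)
  have hdisj : Set.PairwiseDisjoint
      ((Finset.powersetCard (n / 2) Finset.univ : Finset (Finset ι)) : Set (Finset ι)) F := by
    intro T _ T' _ hne
    rw [Function.onFun, Set.disjoint_left]
    intro ω hω hω'
    apply hne
    ext j
    have h3 := (hmem hω j).symm.trans (hmem hω' j)
    by_cases hj : j ∈ T <;> by_cases hj' : j ∈ T' <;> simp only [hj, hj', if_true, if_false] at h3 ⊢
    · linarith
    · linarith
  have hU : P.real (⋃ T ∈ Finset.powersetCard (n / 2) (Finset.univ : Finset ι), F T)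
      = centralProb n := by
    rw [measureReal_biUnion_finset hdisj fun T _ => hFm T]
    simp_rw [hF]
    rw [Finset.sum_const, Finset.card_powersetCard, Finset.card_univ, centralProb, nsmul_eq_mul,
      one_div, inv_pow, div_eq_mul_inv]
  -- The value of the sum when exactly `n / 2` (rounded down) of the signs are positive; this atom
  -- alone has mass `centralProb n`.
  set x : ℝ := (n / 2 : ℕ) * (2 * a) - n * a with hx
  rw [← hU]
  refine le_trans (measureReal_mono ?_) (le_conc P _ t x)
  intro ω hω
  obtain ⟨T, hT, hωT⟩ := Set.mem_iUnion₂.1 hω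
  have hsum : ∑ j, X j ω = x := by
    simp_rw [hmem hωT]
    have h3 (j : ι) : (if j ∈ T then a else -a) = (if j ∈ T then 2 * a else 0) - a := by
      by_cases hj : j ∈ T <;> simp [hj]
      ring
    simp_rw [h3]
    rw [Finset.sum_sub_distrib, Finset.sum_ite_mem, Finset.univ_inter, Finset.sum_const,
      Finset.sum_const, (Finset.mem_powersetCard.1 hT).2, Finset.card_univ]
    simp [hx, ← hn]
  rw [Set.mem_ofPred_eq, hsum]
  exact ⟨le_rfl, by linarith⟩

theorem sqrt_mul_rpow_le_conc_sum_signs {ι : Type*} [Fintype ι] {X : ι → Ω → ℝ}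
    (hX : ∀ j, Measurable (X j)) (hind : iIndepFun X P) {a t : ℝ} (ha : 0 < a) (ht : 0 ≤ t)
    (h1 : ∀ j, P.real {ω | X j ω = a} = 1 / 2) (h2 : ∀ j, P.real {ω | X j ω = -a} = 1 / 2) :
    √(2 / π) * ((Fintype.card ι : ℝ) + 2) ^ (-(1 / 2) : ℝ)
      ≤ conc P (fun ω => ∑ j, X j ω) t := by
  refine le_trans (le_of_eq ?_)
    ((sqrt_le_centralProb _).trans (centralProb_le_conc P hX hind ha ht h1 h2))
  rw [Real.rpow_neg (by positivity), ← Real.sqrt_eq_rpow, ← div_eq_mul_inv,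
    ← Real.sqrt_div (by positivity), div_div]

end Signs

end Concentration

namespace Concentration

open scoped Real Topology

/-! ### Optimality of the constant and the asymptotics -/

section Optimality

theorem conc_sum_bounds {Ω : Type*} [MeasurableSpace Ω] (P : Measure Ω) [IsProbabilityMeasure P]
    {n : ℕ} {X : Fin n → Ω → ℝ} (hX : ∀ j, Measurable (X j)) (hind : iIndepFun X P) {t : ℝ}
    (ht : 0 ≤ t) :
    (∀ j, 1 - conc P (X j) t ≤ spreadProb P (X j) t) ∧
    conc P (fun ω => ∑ j, X j ω) t ≤ G (∑ j, spreadProb P (X j) t) ∧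
    G (∑ j, spreadProb P (X j) t) ≤ G (∑ j, (1 - conc P (X j) t)) ∧
    conc P (fun ω => ∑ j, X j ω) t
      ≤ √(2 / π) * (1 / 4 + ∑ j, spreadProb P (X j) t) ^ (-(1 / 2) : ℝ) ∧
    conc P (fun ω => ∑ j, X j ω) t
      ≤ (1 + ∑ j, (1 - conc P (X j) t)) ^ (-(1 / 2) : ℝ) := by
  have h1 (j : Fin n) := one_sub_conc_le_spreadProb P (hX j) t
  have h2 := conc_sum_le_G P hX hind ht
  have h3 : G (∑ j, spreadProb P (X j) t) ≤ G (∑ j, (1 - conc P (X j) t)) :=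
    G_antitone (Finset.sum_le_sum fun j _ => h1 j)
  refine ⟨h1, h2, h3, h2.trans (G_le_sqrt_mul_rpow ?_), (h2.trans h3).trans (G_le_rpow ?_)⟩
  · exact Finset.sum_nonneg fun j _ => spreadProb_nonneg P (hX j) t
  · exact Finset.sum_nonneg fun j _ => sub_nonneg.2 (conc_le_one P (X j) t)

/-- The shifts `1 / 4` and `2` do not matter in the limit: the ratio of the two powers tends to `1`.
-/
theorem exists_const_mul_lt {C K : ℝ} (h : C < K) :
    ∃ n : ℕ, C * (1 / 4 + (n : ℝ)) ^ (-(1 / 2) : ℝ) < K * ((n : ℝ) + 2) ^ (-(1 / 2) : ℝ) := by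
  have h0 : Tendsto (fun n : ℕ => 7 / 4 / (1 / 4 + (n : ℝ))) atTop (𝓝 0) :=
    tendsto_const_nhds.div_atTop (tendsto_atTop_add_const_left _ _ tendsto_natCast_atTop_atTop)
  have h1 : Tendsto (fun n : ℕ => C * √(1 + 7 / 4 / (1 / 4 + (n : ℝ)))) atTop
      (𝓝 (C * √(1 + 0))) :=
    ((Real.continuous_sqrt.tendsto _).comp (h0.const_add 1)).const_mul C
  rw [add_zero, Real.sqrt_one, mul_one] at h1
  obtain ⟨n, hn⟩ := (h1.eventually_lt_const h).exists
  refine ⟨n, ?_⟩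
  have hA : (0 : ℝ) < 1 / 4 + n := by positivity
  have hB : (0 : ℝ) < n + 2 := by positivity
  have hratio : 1 + 7 / 4 / (1 / 4 + (n : ℝ)) = (n + 2) / (1 / 4 + n) := by
    field_simp
    ring
  rw [hratio, Real.sqrt_div hB.le, mul_div_assoc', div_lt_iff₀ (Real.sqrt_pos.2 hA)] at hn
  rw [Real.rpow_neg hA.le, Real.rpow_neg hB.le, ← Real.sqrt_eq_rpow, ← Real.sqrt_eq_rpow,
    ← div_eq_mul_inv, ← div_eq_mul_inv, div_lt_div_iff₀ (Real.sqrt_pos.2 hA) (Real.sqrt_pos.2 hB)]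
  exact hn

/-- The law of a symmetric sign times `a`. -/
noncomputable def signLaw (a : ℝ) : Measure ℝ :=
  (1 / 2 : ENNReal) • Measure.dirac a + (1 / 2 : ENNReal) • Measure.dirac (-a)

instance (a : ℝ) : IsProbabilityMeasure (signLaw a) :=
  ⟨by simp [signLaw, ENNReal.inv_two_add_inv_two]⟩

theorem signLaw_real_singleton {a : ℝ} (ha : 0 < a) :
    (signLaw a).real {a} = 1 / 2 ∧ (signLaw a).real {-a} = 1 / 2 := by
  have h1 : -a ≠ a := by linarith
  constructor <;> simp [signLaw, measureReal_def, h1, h1.symm]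

theorem exists_signs_lt_conc {t : ℝ} (ht : 0 ≤ t) {C : ℝ} (hC : C < √(2 / π)) :
    ∃ (Ω : Type) (_ : MeasurableSpace Ω) (P : Measure Ω) (n : ℕ) (X : Fin n → Ω → ℝ),
      IsProbabilityMeasure P ∧ (∀ j, Measurable (X j)) ∧ iIndepFun X P ∧
      C * (1 / 4 + ∑ j, spreadProb P (X j) t) ^ (-(1 / 2) : ℝ)
        < conc P (fun ω => ∑ j, X j ω) t := by
  obtain ⟨n, hn⟩ := exists_const_mul_lt hC
  -- Signs of size `t + 1` have gap `2 * (t + 1) > t`, so every spread probability equals `1`.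
  have ha : 0 < t + 1 := by linarith
  have hX (j : Fin n) : Measurable fun u : Fin n → ℝ => u j := measurable_pi_apply j
  have hind : iIndepFun (fun (j : Fin n) (u : Fin n → ℝ) => u j)
      (Measure.pi fun _ : Fin n => signLaw (t + 1)) :=
    iIndepFun_pi (X := fun _ => id) fun _ => aemeasurable_id
  have hlaw (j : Fin n) (x : ℝ) :
      (Measure.pi fun _ : Fin n => signLaw (t + 1)).real {u | u j = x}
        = (signLaw (t + 1)).real {x} := by
    have h := (measurePreserving_eval (fun _ : Fin n => signLaw (t + 1)) j).measureReal_preimage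
      (measurableSet_singleton x).nullMeasurableSet
    exact h
  have h1 (j : Fin n) := (hlaw j (t + 1)).trans (signLaw_real_singleton ha).1
  have h2 (j : Fin n) := (hlaw j (-(t + 1))).trans (signLaw_real_singleton ha).2
  refine ⟨Fin n → ℝ, inferInstance, Measure.pi fun _ => signLaw (t + 1), n, fun j u => u j,
    inferInstance, hX, hind, ?_⟩
  have hs (j : Fin n) := spreadProb_sign _ (hX j) (show t < 2 * (t + 1) by linarith) (h1 j) (h2 j)
  have hlow := sqrt_mul_rpow_le_conc_sum_signs _ hX hind ha ht h1 h2
  simp_rw [hs]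
  rw [Fintype.card_fin] at hlow
  simp only [Finset.sum_const, Finset.card_univ, Fintype.card_fin, nsmul_eq_mul, mul_one]
  exact hn.trans_le hlow

theorem isEquivalent_of_rpow_bounds {c : ℕ → ℝ} {K : ℝ} (hK : 0 < K)
    (hlow : ∀ n : ℕ, K * ((n : ℝ) + 2) ^ (-(1 / 2) : ℝ) ≤ c n)
    (hup : ∀ n : ℕ, c n ≤ K * (1 / 4 + (n : ℝ)) ^ (-(1 / 2) : ℝ)) :
    c ~[atTop] fun n : ℕ => K * (n : ℝ) ^ (-(1 / 2) : ℝ) := by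
  have hne : ∀ᶠ n : ℕ in atTop, K * (n : ℝ) ^ (-(1 / 2) : ℝ) ≠ 0 := by
    filter_upwards [eventually_gt_atTop 0] with n hn
    have : (0 : ℝ) < n := by exact_mod_cast hn
    positivity
  rw [isEquivalent_iff_tendsto_one hne]
  have h0 : Tendsto (fun n : ℕ => √((n : ℝ) / (n + 2))) atTop (𝓝 √1) :=
    (Real.continuous_sqrt.tendsto _).comp (tendsto_natCast_div_add_atTop (2 : ℝ))
  rw [Real.sqrt_one] at h0
  refine tendsto_of_tendsto_of_tendsto_of_le_of_le' h0 tendsto_const_nhds ?_ ?_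
  · filter_upwards [eventually_gt_atTop 0] with n hn
    have hn' : (0 : ℝ) < n := by exact_mod_cast hn
    rw [Pi.div_apply, le_div_iff₀ (by positivity)]
    refine le_trans (le_of_eq ?_) (hlow n)
    rw [Real.rpow_neg hn'.le, Real.rpow_neg (by positivity), ← Real.sqrt_eq_rpow,
      ← Real.sqrt_eq_rpow, Real.sqrt_div hn'.le]
    have := Real.sqrt_pos.2 hn'
    field_simp
  · filter_upwards [eventually_gt_atTop 0] with n hn
    have hn' : (0 : ℝ) < n := by exact_mod_cast hn
    rw [Pi.div_apply, div_le_one (by positivity)]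
    refine (hup n).trans (mul_le_mul_of_nonneg_left ?_ hK.le)
    exact Real.rpow_le_rpow_of_nonpos hn' (by linarith) (by norm_num)

theorem conc_sum_signs_isEquivalent {Ω : Type*} [MeasurableSpace Ω] (P : Measure Ω)
    [IsProbabilityMeasure P] {X : ℕ → Ω → ℝ} (hX : ∀ j, Measurable (X j)) (hind : iIndepFun X P)
    (hP : ∀ j, P {ω | X j ω = 1} = 1 / 2 ∧ P {ω | X j ω = -1} = 1 / 2) :
    (∀ j, spreadProb P (X j) 1 = 1) ∧
    (fun n : ℕ => conc P (fun ω => ∑ j ∈ Finset.range n, X j ω) 1)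
      ~[atTop] (fun n : ℕ => √(2 / π)
        * (∑ j ∈ Finset.range n, spreadProb P (X j) 1) ^ (-(1 / 2) : ℝ)) := by
  have h1 (j : ℕ) : P.real {ω | X j ω = 1} = 1 / 2 := by
    rw [measureReal_def, (hP j).1]
    simp
  have h2 (j : ℕ) : P.real {ω | X j ω = -1} = 1 / 2 := by
    rw [measureReal_def, (hP j).2]
    simp
  have hs (j : ℕ) : spreadProb P (X j) 1 = 1 :=
    spreadProb_sign P (hX j) (a := 1) (by norm_num) (h1 j) (h2 j)
  refine ⟨hs, ?_⟩
  have hXn (n : ℕ) (j : Fin n) : Measurable (X j) := hX j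
  have hindn (n : ℕ) : iIndepFun (fun j : Fin n => X j) P := hind.precomp Fin.val_injective
  have hsum (n : ℕ) : ∑ j ∈ Finset.range n, spreadProb P (X j) 1 = n := by simp [hs]
  have hsum' (n : ℕ) : ∑ j : Fin n, spreadProb P (X j) 1 = n := by simp [hs]
  simp_rw [hsum]
  apply isEquivalent_of_rpow_bounds (by positivity)
  · intro n
    have h := sqrt_mul_rpow_le_conc_sum_signs P (hXn n) (hindn n) one_pos zero_le_one
      (fun j => h1 j) (fun j => h2 j)
    rw [Fintype.card_fin] at h
    simpa only [Finset.sum_range] using h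
  · intro n
    have h := (conc_sum_bounds P (hXn n) (hindn n) zero_le_one).2.2.2.1
    rw [hsum'] at h
    simpa only [Finset.sum_range] using h

end Optimality

end Concentration

theorem corollary1p5 :
    -- the inequalities
    (∀ (Ω : Type*) [MeasurableSpace Ω] (P : Measure Ω) [IsProbabilityMeasure P]
      (n : ℕ) (X : Fin n → Ω → ℝ), (∀ j, Measurable (X j)) → iIndepFun X P →
      ∀ t : ℝ, 0 ≤ t →
        (∀ j, 1 - Concentration.conc P (X j) t ≤ Concentration.spreadProb P (X j) t) ∧
        Concentration.conc P (fun ω => ∑ j, X j ω) t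
          ≤ Concentration.G (∑ j, Concentration.spreadProb P (X j) t) ∧
        Concentration.G (∑ j, Concentration.spreadProb P (X j) t)
          ≤ Concentration.G (∑ j, (1 - Concentration.conc P (X j) t)) ∧
        Concentration.conc P (fun ω => ∑ j, X j ω) t
          ≤ Real.sqrt (2 / Real.pi)
            * (1 / 4 + ∑ j, Concentration.spreadProb P (X j) t) ^ (-(1 / 2) : ℝ) ∧
        Concentration.conc P (fun ω => ∑ j, X j ω) t
          ≤ (1 + ∑ j, (1 - Concentration.conc P (X j) t)) ^ (-(1 / 2) : ℝ)) ∧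
    -- for each `t`, the constant `√(2/π)` cannot be replaced by a smaller one
    (∀ t : ℝ, 0 ≤ t → ∀ C : ℝ, C < Real.sqrt (2 / Real.pi) →
      ∃ (Ω : Type) (_ : MeasurableSpace Ω) (P : Measure Ω) (n : ℕ) (X : Fin n → Ω → ℝ),
        IsProbabilityMeasure P ∧ (∀ j, Measurable (X j)) ∧ iIndepFun X P ∧
        C * (1 / 4 + ∑ j, Concentration.spreadProb P (X j) t) ^ (-(1 / 2) : ℝ)
          < Concentration.conc P (fun ω => ∑ j, X j ω) t) ∧
    -- for `t = 1` and symmetric signs, the bound is asymptotically attained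
    (∀ (Ω : Type*) [MeasurableSpace Ω] (P : Measure Ω) [IsProbabilityMeasure P]
      (X : ℕ → Ω → ℝ), (∀ j, Measurable (X j)) → iIndepFun X P →
      (∀ j, P {ω | X j ω = 1} = 1 / 2 ∧ P {ω | X j ω = -1} = 1 / 2) →
        (∀ j, Concentration.spreadProb P (X j) 1 = 1) ∧
        (fun n : ℕ => Concentration.conc P (fun ω => ∑ j ∈ Finset.range n, X j ω) 1)
          ~[atTop] (fun n : ℕ => Real.sqrt (2 / Real.pi)
            * (∑ j ∈ Finset.range n, Concentration.spreadProb P (X j) 1) ^ (-(1 / 2) : ℝ))) := by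
  refine ⟨?_, ?_, ?_⟩
  · intro Ω _ P _ n X hX hind t ht
    exact Concentration.conc_sum_bounds P hX hind ht
  · intro t ht C hC
    exact Concentration.exists_signs_lt_conc ht hC
  · intro Ω _ P _ X hX hind hP
    exact Concentration.conc_sum_signs_isEquivalent P hX hind hP
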